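/- Let $d\ge 1$, let $H$ be a complex Hilbert space of dimension $d$ with orthonormal basis $e_1,\dots,e_d$, and let $\mathcal F(H)=\bigoplus_{n\ge 0}H^{\otimes n}$ (Hilbert space direct sum, $H^{\otimes 0}=\mathbb C\Omega$ with $\|\Omega\|=1$) be the full Fock space of $H$. For $f\in H$ let $l(f)$ and $r(f)$ be the left and right creation operators, i.e. the bounded operators on $\mathcal F(H)$ with $l(f)\xi=f\otimes\xi$ and $r(f)\xi=\xi\otimes f$ for $\xi\in H^{\otimes n}$, $n\ge 0$ (where $f\otimes\Omega=\Omega\otimes f=f$). Put $l_i=l(e_i)$, $r_i=r(e_i)$ and $s_i=l_i+l_i^*$ for $1\le i\le d$, so that $\mathbf{s}=(s_1,\dots,s_d)$ is a tuple of free semicircular elements. Let $\mathbb C\langle\mathbf{s}\rangle$ be the unital algebra of noncommutative polynomials in $s_1,\dots,s_d$, and let $L^\infty(\mathbf{s})\subset B(\mathcal F(H))$ be the von Neumann algebra generated by $s_1,\dots,s_d$. Let $C_{\mathrm{div}}(\mathbf{s})$ be the division closure of $\mathbb C\langle\mathbf{s}\rangle$ in $L^\infty(\mathbf{s})$, i.e.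 the smallest unital subalgebra $\mathcal C$ of $L^\infty(\mathbf{s})$ that contains $\mathbb C\langle\mathbf{s}\rangle$ and satisfies $x^{-1}\in\mathcal C$ whenever $x\in\mathcal C$ is invertible in $L^\infty(\mathbf{s})$. Let $C_{\mathrm{rat}}(\mathbf{s})$ be the rational closure of $\mathbb C\langle\mathbf{s}\rangle$ in $L^\infty(\mathbf{s})$, i.e. the smallest unital subalgebra $\mathcal D$ of $L^\infty(\mathbf{s})$ that contains $\mathbb C\langle\mathbf{s}\rangle$ and satisfies, for every $n\in\mathbb N$, $X^{-1}\in M_n(\mathcal D)$ whenever $X\in M_n(\mathcal D)$ is invertible in $M_n(L^\infty(\mathbf{s}))$. Then for every $a\in L^\infty(\mathbf{s})$, the commutators $[r_i^*,a]=r_i^*a-ar_i^*$, $i=1,\dots,d$, are all finite rank operators on $\mathcal F(H)$ if and only if $a\in C_{\mathrm{div}}(\mathbf{s})$. In addition, $$C_{\mathrm{div}}(\mathbf{s})=C_{\mathrm{rat}}(\mathbf{s})\subset\overline{\mathbb C\langle\mathbf{s}\rangle},$$ where $\overline{\mathbb C\langle\mathbf{s}\rangle}$ is the closure of $\mathbb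 C\langle\mathbf{s}\rangle$ in $L^\infty(\mathbf{s})$ in the operator norm. -/

import Mathlib

open scoped TensorProduct

universe u

noncomputable section

namespace FreeFock

/-! ### Full Fock space -/

/-- A bundled finite-dimensional complex Hilbert space (used to define the tensor powers `H^{⊗ n}`
by recursion, each with its inner product). -/
structure FinHilb : Type (u + 1) where
  carrier : Type u
  [normed : NormedAddCommGroup carrier]
  [inner : InnerProductSpace ℂ carrier]
  [finDim : FiniteDimensional ℂ carrier]

attribute [instance] FinHilb.normed FinHilb.inner FinHilb.finDim

variable (H : Type u) [NormedAddCommGroup H] [InnerProductSpace ℂ H] [FiniteDimensional ℂ H]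

/-- The Hilbert space tensor powers: `H^{⊗ 0}` is the one-dimensional Hilbert space `ℂ Ω` and
`H^{⊗ (n + 1)} = H ⊗ H^{⊗ n}`, where Mathlib's inner product on a tensor product is determined by
`⟪x ⊗ y, x' ⊗ y'⟫ = ⟪x, x'⟫ * ⟪y, y'⟫`. -/
def tensorPow : ℕ → FinHilb.{u}
  | 0 => ⟨EuclideanSpace ℂ PUnit.{u + 1}⟩
  | n + 1 => ⟨H ⊗[ℂ] (tensorPow n).carrier⟩

/-- The underlying type of `H^{⊗ n}`. -/
abbrev TPow (n : ℕ) : Type u := (tensorPow H n).carrier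

/-- The full Fock space of `H`: the orthogonal (Hilbert space) direct sum of all `H^{⊗ n}`. -/
abbrev Fock : Type u := lp (fun n : ℕ => TPow H n) 2

variable {H}

/-- Left tensoring `ξ ↦ f ⊗ ξ` from `H^{⊗ n}` to `H^{⊗ (n + 1)}`. -/
def leftTensor (f : H) (n : ℕ) : TPow H n →L[ℂ] TPow H (n + 1) :=
  TensorProduct.mkL ℂ H (TPow H n) f

/-- Right tensoring `ξ ↦ ξ ⊗ f` from `H^{⊗ n}` to `H^{⊗ (n + 1)}`: one has `Ω ⊗ f = f = f ⊗ Ω`, and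
`(h ⊗ ξ) ⊗ f = h ⊗ (ξ ⊗ f)` for `h` in `H`. -/
def rightTensor (f : H) : (n : ℕ) → (TPow H n →L[ℂ] TPow H (n + 1))
  | 0 => TensorProduct.mkL ℂ H (TPow H 0) f
  | n + 1 => (rightTensor f n).lTensor H

theorem norm_leftTensor_le (f : H) (n : ℕ) : ‖leftTensor f n‖ ≤ ‖f‖ :=
  ContinuousLinearMap.opNorm_le_bound _ (norm_nonneg f)
    fun ξ => (TensorProduct.norm_tmul (𝕜 := ℂ) f ξ).le

theorem norm_rightTensor_le (f : H) : ∀ n : ℕ, ‖rightTensor f n‖ ≤ ‖f‖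
  | 0 => norm_leftTensor_le f 0
  | n + 1 => (ContinuousLinearMap.norm_lTensor_le (G := H) (rightTensor f n)).trans
      (norm_rightTensor_le f n)

/-- The sequence `(0, A₀ x₀, A₁ x₁, …)`. -/
def raiseFun (A : (n : ℕ) → (TPow H n →L[ℂ] TPow H (n + 1))) (x : (n : ℕ) → TPow H n) :
    (n : ℕ) → TPow H n
  | 0 => 0
  | n + 1 => A n (x n)

theorem hasSum_raiseFun_le {A : (n : ℕ) → (TPow H n →L[ℂ] TPow H (n + 1))} {C : ℝ}
    (hA : ∀ n, ‖A n‖ ≤ C) (x : Fock H) :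
    Summable (fun n => ‖raiseFun A x n‖ ^ (2 : ENNReal).toReal) ∧
      ∑' n, ‖raiseFun A x n‖ ^ (2 : ENNReal).toReal ≤ (C * ‖x‖) ^ (2 : ENNReal).toReal := by
  have hC : 0 ≤ C := (norm_nonneg _).trans (hA 0)
  have h2 : (0 : ℝ) < (2 : ENNReal).toReal := by norm_num
  have hx := lp.hasSum_norm h2 x
  have hle : ∀ n, ‖raiseFun A x (n + 1)‖ ^ (2 : ENNReal).toReal ≤
      C ^ (2 : ENNReal).toReal * ‖x n‖ ^ (2 : ENNReal).toReal := fun n => by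
    rw [← Real.mul_rpow hC (norm_nonneg _)]
    exact Real.rpow_le_rpow (norm_nonneg _) ((A n).le_of_opNorm_le (hA n) (x n)) h2.le
  have hs' : Summable fun n => ‖raiseFun A x (n + 1)‖ ^ (2 : ENNReal).toReal :=
    Summable.of_nonneg_of_le (fun n => by positivity) hle (hx.summable.mul_left _)
  have hs : Summable fun n => ‖raiseFun A x n‖ ^ (2 : ENNReal).toReal :=
    (summable_nat_add_iff 1).1 hs'
  refine ⟨hs, ?_⟩
  rw [hs.tsum_eq_zero_add, Real.mul_rpow hC (norm_nonneg _), ← hx.tsum_eq, ← tsum_mul_left]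
  have h0 : ‖raiseFun A x 0‖ ^ (2 : ENNReal).toReal = 0 := by simp [raiseFun]
  rw [h0, zero_add]
  exact hs'.tsum_le_tsum hle (hx.summable.mul_left _)

/-- The bounded operator `x ↦ (0, A₀ x₀, A₁ x₁, …)` on the full Fock space defined by a uniformly
bounded family of operators `Aₙ : H^{⊗ n} → H^{⊗ (n + 1)}`. -/
def raise (A : (n : ℕ) → (TPow H n →L[ℂ] TPow H (n + 1))) (C : ℝ) (hA : ∀ n, ‖A n‖ ≤ C) :
    Fock H →L[ℂ] Fock H :=
  LinearMap.mkContinuous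
    { toFun := fun x => ⟨raiseFun A x, memℓp_gen (hasSum_raiseFun_le hA x).1⟩
      map_add' := fun x y => by
        ext n
        cases n with
        | zero => exact (add_zero (0 : TPow H 0)).symm
        | succ n => exact map_add (A n) (x n) (y n)
      map_smul' := fun c x => by
        ext n
        cases n with
        | zero => exact (smul_zero c).symm
        | succ n => exact map_smul (A n) c (x n) }
    C fun x => lp.norm_le_of_tsum_le (by norm_num)
      (mul_nonneg ((norm_nonneg _).trans (hA 0)) (norm_nonneg x)) (hasSum_raiseFun_le hA x).2

/-- The left creation operator `l(f)`, `l(f) ξ = f ⊗ ξ`. -/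
def leftCreation (f : H) : Fock H →L[ℂ] Fock H :=
  raise (leftTensor f) ‖f‖ (norm_leftTensor_le f)

/-- The right creation operator `r(f)`, `r(f) ξ = ξ ⊗ f`. -/
def rightCreation (f : H) : Fock H →L[ℂ] Fock H :=
  raise (rightTensor f) ‖f‖ (norm_rightTensor_le f)

/-- The right annihilation operator `r(f)^*`. -/
def rightAnnihilation (f : H) : Fock H →L[ℂ] Fock H :=
  ContinuousLinearMap.adjoint (rightCreation f)

/-! ### Free semicircular elements and the von Neumann algebra they generate -/

/-- The von Neumann algebra generated by a set `S` of bounded operators on a Hilbert space: the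
double commutant of `S ∪ S^*`. -/
def vonNeumannClosure {K : Type u} [NormedAddCommGroup K] [InnerProductSpace ℂ K] [CompleteSpace K]
    (S : Set (K →L[ℂ] K)) : VonNeumannAlgebra K where
  toStarSubalgebra := StarSubalgebra.centralizer ℂ
    (StarSubalgebra.centralizer ℂ S : Set (K →L[ℂ] K))
  centralizer_centralizer' := by
    change Set.centralizer (Set.centralizer
      (StarSubalgebra.centralizer ℂ
        (StarSubalgebra.centralizer ℂ S : Set (K →L[ℂ] K)) : Set (K →L[ℂ] K))) =
      (StarSubalgebra.centralizer ℂ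
        (StarSubalgebra.centralizer ℂ S : Set (K →L[ℂ] K)) : Set (K →L[ℂ] K))
    rw [StarSubalgebra.coe_centralizer_centralizer, Set.centralizer_centralizer_centralizer]

theorem subset_vonNeumannClosure {K : Type u} [NormedAddCommGroup K] [InnerProductSpace ℂ K]
    [CompleteSpace K] (S : Set (K →L[ℂ] K)) : S ⊆ vonNeumannClosure S := by
  change S ⊆ (StarSubalgebra.centralizer ℂ
        (StarSubalgebra.centralizer ℂ S : Set (K →L[ℂ] K)) : Set (K →L[ℂ] K))
  rw [StarSubalgebra.coe_centralizer_centralizer]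
  exact Set.subset_union_left.trans Set.subset_centralizer_centralizer

variable {d : ℕ} (e : OrthonormalBasis (Fin d) ℂ H)

/-- The semicircular elements `s_i = l(e_i) + l(e_i)^*`, as bounded operators. -/
def semicircular (i : Fin d) : Fock H →L[ℂ] Fock H :=
  leftCreation (e i) + ContinuousLinearMap.adjoint (leftCreation (e i))

/-- `L^∞(s)`, the von Neumann algebra generated by `s = (s_1, …, s_d)`. -/
def LInf : VonNeumannAlgebra (Fock H) :=
  vonNeumannClosure (Set.range (semicircular e))

/-- `L^∞(s)` as a type; it is a unital complex algebra with the operator norm. -/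
abbrev LInfAlg : Type u := (LInf e).toStarSubalgebra

/-- The element `s_i` of `L^∞(s)`. -/
def s (i : Fin d) : LInfAlg e :=
  ⟨semicircular e i, subset_vonNeumannClosure _ ⟨i, rfl⟩⟩

/-- `ℂ⟨s⟩`, the algebra of noncommutative polynomials in `s`, as a subalgebra of `L^∞(s)`. -/
def polys : Subalgebra ℂ (LInfAlg e) :=
  Algebra.adjoin ℂ (Set.range (s e))

/-! ### Division closure and rational closure -/

section Closures

variable {A : Type u} [Ring A] [Algebra ℂ A]

/-- `C` is closed under inverses of elements which are invertible in `A`. -/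
def IsDivisionClosed (C : Subalgebra ℂ A) : Prop :=
  ∀ x : Aˣ, (x : A) ∈ C → ((x⁻¹ : Aˣ) : A) ∈ C

/-- Square matrices over `C` of any size which are invertible over `A` have inverses over `C`. -/
def IsRationallyClosed (C : Subalgebra ℂ A) : Prop :=
  ∀ (n : ℕ) (X : (Matrix (Fin n) (Fin n) A)ˣ),
    (∀ i j, (X : Matrix (Fin n) (Fin n) A) i j ∈ C) →
      ∀ i j, ((X⁻¹ : (Matrix (Fin n) (Fin n) A)ˣ) : Matrix (Fin n) (Fin n) A) i j ∈ C

/-- The division closure of `B` in `A`. -/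
def divisionClosure (B : Subalgebra ℂ A) : Subalgebra ℂ A :=
  sInf {C | B ≤ C ∧ IsDivisionClosed C}

/-- The rational closure of `B` in `A`. -/
def rationalClosure (B : Subalgebra ℂ A) : Subalgebra ℂ A :=
  sInf {C | B ≤ C ∧ IsRationallyClosed C}

/-- The division closure is the smallest division closed subalgebra containing `B`. -/
theorem divisionClosure_isLeast (B : Subalgebra ℂ A) :
    IsLeast {C | B ≤ C ∧ IsDivisionClosed C} (divisionClosure B) :=
  ⟨⟨le_sInf fun _ hC => hC.1, fun x hx => Algebra.mem_sInf.2 fun C hC =>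
    hC.2 x (Algebra.mem_sInf.1 hx C hC)⟩, fun _ hC => sInf_le hC⟩

/-- The rational closure is the smallest rationally closed subalgebra containing `B`. -/
theorem rationalClosure_isLeast (B : Subalgebra ℂ A) :
    IsLeast {C | B ≤ C ∧ IsRationallyClosed C} (rationalClosure B) :=
  ⟨⟨le_sInf fun _ hC => hC.1, fun n X hX i j => Algebra.mem_sInf.2 fun C hC =>
    hC.2 n X (fun i j => Algebra.mem_sInf.1 (hX i j) C hC) i j⟩, fun _ hC => sInf_le hC⟩

end Closures

/-- `C_div(s)`, the division closure of `ℂ⟨s⟩` in `L^∞(s)`. -/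
def Cdiv : Subalgebra ℂ (LInfAlg e) := divisionClosure (polys e)

/-- `C_rat(s)`, the rational closure of `ℂ⟨s⟩` in `L^∞(s)`. -/
def Crat : Subalgebra ℂ (LInfAlg e) := rationalClosure (polys e)

/-- A bounded operator has finite rank if its range is finite dimensional. -/
def IsFiniteRank {K : Type u} [NormedAddCommGroup K] [InnerProductSpace ℂ K]
    (T : K →L[ℂ] K) : Prop :=
  FiniteDimensional ℂ (LinearMap.range (T : K →ₗ[ℂ] K))

end FreeFock

end

/-! Everything rests on the relation `[r_i^*, s_j] = δ_ij P`, with `P` the projection onto `ℂ Ω`.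
Commutation with `r_i^*` is a derivation and the finite rank operators form an ideal, so the
elements with finite rank commutators form an algebra containing the polynomials. For matrices, `[G,
X⁻¹] = -X⁻¹ [G, X] X⁻¹` shows that this algebra is rationally closed, hence contains `C_rat`, which
contains `C_div`.

Conversely, `a ∈ L^∞(s)` commutes with `r_i + r_i^*`, so `[r_i^*, a] = [a, r_i]`. It follows that
the ranges of these commutators together with `a Ω` span a finite dimensional space `V` invariant
under every `r_i^*` (`exists_finiteDimensional_invariant`). In an orthonormal basis of `V` let `b_i`
be the matrix of `r_i^*`, and put `L = (1 - ∑ b_i ⊗ l_i^*) (1 - ∑ b_i ⊗ l_i)`. Because `l_i^* l_j =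
δ_ij`, this equals `1 - ∑ b_i ⊗ s_i + ∑ b_i²`, which is affine in `s`. The sums of `‖r_w^* x‖²` over
words `w` of length `k` are tails of `‖x‖²`; they bound the `k`-th powers of both pencils, so `L` is
invertible. Under `r_i^*` the vectors `(L⁻¹)_{pq} Ω` obey the same recursion as the basis of `V`
(`linearPencil_vacuum`). A vector is determined by the vacuum components of all its images `r_w^*
x`, so `a Ω = c Ω` with `c` a combination of entries of `L⁻¹`. As `Ω` is separating, `a = c`.

To place the entries of `L⁻¹` in `C_div`, scale both pencils by `t ∈ [0, 1]`: this joins `1` to `L`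
through invertible matrices, and each short step along the path is a Gaussian elimination inverting
only elements near `1`. The argument thus works in any algebra closed under such inverses, which
covers `C_div` and the norm closure of the polynomials at once. -/

noncomputable section

/-! ### Inverses of matrices over algebras closed under inverses near the identity -/

namespace FreeFock

open Filter Topology

section NearOne

variable {B : Type*} [NormedRing B] [NormOneClass B] [CompleteSpace B] [Algebra ℂ B]

/-- `C` contains the inverses of its elements which are at distance less than `1` from `1`. -/
def IsNearOneClosed (C : Subalgebra ℂ B) : Prop :=
  ∀ x : Bˣ, (x : B) ∈ C → ‖(x : B) - 1‖ < 1 → ((x⁻¹ : Bˣ) : B) ∈ C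

theorem norm_inv_le_two {B : Type*} [NormedRing B] [NormOneClass B] (x : Bˣ)
    (hx : ‖(x : B) - 1‖ ≤ 1 / 2) : ‖((x⁻¹ : Bˣ) : B)‖ ≤ 2 := by
  have h : ((x⁻¹ : Bˣ) : B) = 1 - (x⁻¹ : Bˣ) * ((x : B) - 1) := by
    rw [mul_sub, Units.inv_mul, mul_one]; abel
  have h1 : ‖((x⁻¹ : Bˣ) : B)‖ ≤ 1 + ‖((x⁻¹ : Bˣ) : B)‖ * (1 / 2) := by
    conv_lhs => rw [h]
    refine (norm_sub_le _ _).trans ?_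
    rw [norm_one]
    gcongr
    exact (norm_mul_le _ _).trans (by gcongr)
  linarith

/-- Gaussian elimination for linear systems whose matrix is close to the identity. -/
theorem IsNearOneClosed.exists_solution_mem {C : Subalgebra ℂ B} (hC : IsNearOneClosed C) (n : ℕ) :
    ∃ ε : ℝ, 0 < ε ∧ ∀ Q : Matrix (Fin n) (Fin n) B, (∀ i j, Q i j ∈ C) →
      (∀ i j, ‖Q i j - (1 : Matrix (Fin n) (Fin n) B) i j‖ < ε) →
      ∀ y : Fin n → B, (∀ i, ∑ j, Q i j * y j ∈ C) → ∀ i, y i ∈ C := by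
  induction n with
  | zero => exact ⟨1, one_pos, fun _ _ _ _ _ i => i.elim0⟩
  | succ n ih =>
    obtain ⟨ε, hε, ih⟩ := ih
    -- With pivot inverse of norm at most `2`, an entry of the Schur complement is off by less than
    -- `η + 2η²`; `η ≤ 1/2` bounds this by `2η`, and `η ≤ ε/2` by `ε`.
    refine ⟨min (ε / 2) (1 / 2), by positivity, fun Q hQ hQ1 y hy => ?_⟩
    set η := min (ε / 2) (1 / 2) with hη
    have hη1 : η ≤ ε / 2 := min_le_left _ _
    have hη2 : η ≤ 1 / 2 := min_le_right _ _
    have h00 : ‖Q 0 0 - 1‖ < η := by simpa using hQ1 0 0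
    obtain ⟨q, hq⟩ : IsUnit (Q 0 0) := by
      have := isUnit_one_sub_of_norm_lt_one (x := 1 - Q 0 0)
        (by rw [norm_sub_rev]; linarith)
      simpa using this
    have hqC : ((q⁻¹ : Bˣ) : B) ∈ C := hC q (hq ▸ hQ 0 0) (by rw [hq]; linarith)
    have hqn : ‖((q⁻¹ : Bˣ) : B)‖ ≤ 2 := norm_inv_le_two q (by rw [hq]; linarith)
    have hy0 : y 0 = (q⁻¹ : Bˣ) * (∑ j, Q 0 j * y j - ∑ j : Fin n, Q 0 j.succ * y j.succ) := by
      rw [Fin.sum_univ_succ, add_sub_cancel_right, ← hq, Units.inv_mul_cancel_left]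
    -- Eliminating `y 0` leaves a system whose matrix is the Schur complement of the pivot `Q 0 0`.
    have hsucc : ∀ i : Fin n, y i.succ ∈ C := by
      refine ih (fun i j => Q i.succ j.succ - Q i.succ 0 * (q⁻¹ : Bˣ) * Q 0 j.succ)
        (fun i j => C.sub_mem (hQ _ _) (C.mul_mem (C.mul_mem (hQ _ _) hqC) (hQ _ _)))
        (fun i j => ?_) (fun i => y i.succ) (fun i => ?_)
      · have h1 : ‖Q i.succ 0‖ ≤ η := by
          have := hQ1 i.succ 0
          rw [Matrix.one_apply_ne (Fin.succ_ne_zero i), sub_zero] at this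
          exact this.le
        have h2 : ‖Q 0 j.succ‖ ≤ η := by
          have := hQ1 0 j.succ
          rw [Matrix.one_apply_ne (Fin.succ_ne_zero j).symm, sub_zero] at this
          exact this.le
        have h3 : ‖Q i.succ j.succ - (1 : Matrix (Fin n) (Fin n) B) i j‖ < η := by
          have := hQ1 i.succ j.succ
          simpa [Matrix.one_apply] using this
        have h4 : ‖Q i.succ 0 * (q⁻¹ : Bˣ) * Q 0 j.succ‖ ≤ η * 2 * η :=
          (norm_mul_le _ _).trans (mul_le_mul ((norm_mul_le _ _).trans
            (mul_le_mul h1 hqn (norm_nonneg _) ((norm_nonneg _).trans h1))) h2 (norm_nonneg _)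
            (mul_nonneg ((norm_nonneg _).trans h1) zero_le_two))
        have h5 : η * 2 * η ≤ η := by
          have := (norm_nonneg _).trans h1
          nlinarith
        rw [sub_right_comm]
        calc _ ≤ _ := norm_sub_le _ _
          _ < ε := by linarith
      · have : ∑ j : Fin n, (Q i.succ j.succ - Q i.succ 0 * (q⁻¹ : Bˣ) * Q 0 j.succ) * y j.succ =
            ∑ j, Q i.succ j * y j - Q i.succ 0 * ((q⁻¹ : Bˣ) * ∑ j, Q 0 j * y j) := by
          rw [Fin.sum_univ_succ (fun j => Q i.succ j * y j), hy0]
          simp only [sub_mul, Finset.sum_sub_distrib, mul_sub, mul_assoc, Finset.mul_sum]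
          abel
        rw [this]
        exact C.sub_mem (hy _) (C.mul_mem (hQ _ _) (C.mul_mem hqC (hy 0)))
    intro i
    refine Fin.cases ?_ hsucc i
    rw [hy0]
    exact C.mul_mem hqC (C.sub_mem (hy 0) (C.sum_mem fun j _ => C.mul_mem (hQ _ _) (hsucc j)))

-- Matrix norms and paths of invertible matrices

attribute [local instance] Matrix.linftyOpNormedRing Matrix.linftyOpNormedAlgebra
  Matrix.linftyOpNormedAddCommGroup

theorem norm_matrix_apply_le {B : Type*} [NormedRing B] {n : ℕ}
    (Q : Matrix (Fin n) (Fin n) B) (i j : Fin n) :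
    ‖Q i j‖ ≤ ‖Q‖ := by
  rw [Matrix.linfty_opNorm_def, ← coe_nnnorm, NNReal.coe_le_coe]
  exact (Finset.single_le_sum (f := fun j => ‖Q i j‖₊) (fun _ _ => zero_le)
    (Finset.mem_univ j)).trans (Finset.le_sup (f := fun i => ∑ j, ‖Q i j‖₊) (Finset.mem_univ i))

theorem norm_matrix_le_sum {B : Type*} [NormedRing B] {n : ℕ} (Q : Matrix (Fin n) (Fin n) B) :
    ‖Q‖ ≤ ∑ i, ∑ j, ‖Q i j‖ := by
  have : ‖Q‖₊ ≤ ∑ i, ∑ j, ‖Q i j‖₊ := by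
    rw [Matrix.linfty_opNNNorm_def]
    exact Finset.sup_le fun i _ => Finset.single_le_sum (f := fun i => ∑ j, ‖Q i j‖₊)
      (fun _ _ => zero_le) (Finset.mem_univ i)
  have h := NNReal.coe_le_coe.2 this
  push_cast at h
  exact h

theorem hasSummableGeomSeries_matrix {B : Type*} [NormedRing B] [CompleteSpace B] (n : ℕ) :
    HasSummableGeomSeries (Matrix (Fin n) (Fin n) B) := by
  have : @CompleteSpace (Matrix (Fin n) (Fin n) B) PseudoMetricSpace.toUniformSpace :=
    inferInstanceAs (CompleteSpace (Fin n → Fin n → B))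
  infer_instance

/-- If `T` is a path of invertible matrices over `C` starting at `1`, then the inverse of its end
point has entries in `C`. -/
theorem IsNearOneClosed.inverse_path_mem {C : Subalgebra ℂ B} (hC : IsNearOneClosed C) {n : ℕ}
    (T : ℝ → Matrix (Fin n) (Fin n) B) (hT : Continuous T) (hT0 : T 0 = 1)
    (hTC : ∀ t i j, T t i j ∈ C) (hTu : ∀ t ∈ Set.Icc (0 : ℝ) 1, IsUnit (T t)) (i j : Fin n) :
    Ring.inverse (T 1) i j ∈ C := by
  have := hasSummableGeomSeries_matrix (B := B) n
  obtain ⟨ε, hε, h⟩ := hC.exists_solution_mem n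
  set P : ℝ → Prop := fun t => ∀ i j, Ring.inverse (T t) i j ∈ C
  -- The columns of `(T t)⁻¹` solve a system with matrix `(T s)⁻¹ T t` near `1` and right-hand side
  -- the columns of `(T s)⁻¹`.
  have near : ∀ s t, IsUnit (T s) → IsUnit (T t) → ‖Ring.inverse (T s) * T t - 1‖ < ε →
      P s → P t := by
    intro s t hs ht hst hP i j
    refine h (Ring.inverse (T s) * T t) (fun i j => ?_) (fun i j => ?_)
      (fun k => Ring.inverse (T t) k j) (fun i => ?_) i
    · rw [Matrix.mul_apply]
      exact C.sum_mem fun k _ => C.mul_mem (hP _ _) (hTC _ _ _)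
    · rw [← Matrix.sub_apply]
      exact (norm_matrix_apply_le _ _ _).trans_lt hst
    · rw [← Matrix.mul_apply, mul_assoc, Ring.mul_inverse_cancel _ ht, mul_one]
      exact hP _ _
  have key : P 0 → P 1 := by
    -- Connectedness propagates a transitive relation that holds locally in both directions;
    -- continuity of inversion gives the second direction.
    refine isPreconnected_Icc.induction₂' (fun s t => P s → P t) (fun s hs => ?_)
      (fun _ _ _ _ _ _ h1 h2 h0 => h2 (h1 h0))
      (Set.left_mem_Icc.2 zero_le_one) (Set.right_mem_Icc.2 zero_le_one)
    have hcont : ContinuousAt (fun t => Ring.inverse (T t)) s := by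
      obtain ⟨u, hu⟩ := hTu s hs
      have := NormedRing.inverse_continuousAt u
      rw [hu] at this
      exact ContinuousAt.comp (f := T) this hT.continuousAt
    have h1 : Tendsto (fun t => ‖Ring.inverse (T s) * T t - 1‖) (𝓝 s) (𝓝 0) := by
      have : ContinuousAt (fun t => ‖Ring.inverse (T s) * T t - 1‖) s :=
        ((continuousAt_const.mul hT.continuousAt).sub continuousAt_const).norm
      simpa [ContinuousAt, Ring.inverse_mul_cancel _ (hTu s hs)] using this
    have h2 : Tendsto (fun t => ‖Ring.inverse (T t) * T s - 1‖) (𝓝 s) (𝓝 0) := by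
      have : ContinuousAt (fun t => ‖Ring.inverse (T t) * T s - 1‖) s :=
        ((hcont.mul continuousAt_const).sub continuousAt_const).norm
      simpa [ContinuousAt, Ring.inverse_mul_cancel _ (hTu s hs)] using this
    filter_upwards [nhdsWithin_le_nhds (h1.eventually_lt_const hε),
      nhdsWithin_le_nhds (h2.eventually_lt_const hε), self_mem_nhdsWithin] with t ht1 ht2 ht
    exact ⟨near s t (hTu s hs) (hTu t ht) ht1, near t s (hTu t ht) (hTu s hs) ht2⟩
  refine key (fun i j => ?_) i j
  rw [hT0, Ring.inverse_one, Matrix.one_apply]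
  split_ifs
  exacts [C.one_mem, C.zero_mem]

end NearOne

end FreeFock

/-! ### Operators on the full Fock space -/

namespace FreeFock
open Filter Topology ContinuousLinearMap
open scoped InnerProductSpace

variable {H : Type u} [NormedAddCommGroup H] [InnerProductSpace ℂ H] [FiniteDimensional ℂ H]

/-- The unit vector of `H^{⊗ 0}`. -/
def vacuumZero : TPow H 0 := EuclideanSpace.single (PUnit.unit : PUnit.{u + 1}) (1 : ℂ)

variable (H) in
/-- The vacuum vector `Ω` of the Fock space. -/
def vacuum : Fock H := lp.single 2 0 vacuumZero

theorem inner_vacuumZero_smul (u : TPow H 0) : ⟪vacuumZero, u⟫_ℂ • (vacuumZero : TPow H 0) = u := by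
  change EuclideanSpace ℂ PUnit.{u + 1} at u
  change ⟪(EuclideanSpace.single (PUnit.unit : PUnit.{u + 1}) (1 : ℂ)), u⟫_ℂ •
    (EuclideanSpace.single (PUnit.unit : PUnit.{u + 1}) (1 : ℂ)) = u
  ext i
  simp [EuclideanSpace.inner_single_left]

theorem vacuum_apply_zero : (vacuum H : Fock H) 0 = vacuumZero := lp.single_apply_self ..

theorem vacuum_apply_succ (n : ℕ) : (vacuum H : Fock H) (n + 1) = 0 :=
  lp.single_apply_ne _ _ _ (Nat.succ_ne_zero n)

theorem norm_vacuumZero : ‖(vacuumZero : TPow H 0)‖ = 1 := by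
  change ‖(EuclideanSpace.single (PUnit.unit : PUnit.{u + 1}) (1 : ℂ))‖ = 1
  simp

theorem norm_vacuum : ‖vacuum H‖ = 1 := by
  rw [vacuum, lp.norm_single (by norm_num), norm_vacuumZero]

theorem inner_vacuum (x : Fock H) : ⟪vacuum H, x⟫_ℂ = ⟪vacuumZero, x 0⟫_ℂ :=
  lp.inner_single_left 0 _ x

theorem raise_apply_zero {A : (n : ℕ) → (TPow H n →L[ℂ] TPow H (n + 1))} {C : ℝ}
    (hA : ∀ n, ‖A n‖ ≤ C) (x : Fock H) : raise A C hA x 0 = 0 := rfl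

theorem raise_apply_succ {A : (n : ℕ) → (TPow H n →L[ℂ] TPow H (n + 1))} {C : ℝ}
    (hA : ∀ n, ‖A n‖ ≤ C) (x : Fock H) (n : ℕ) : raise A C hA x (n + 1) = A n (x n) := rfl

theorem raise_single {A : (n : ℕ) → (TPow H n →L[ℂ] TPow H (n + 1))} {C : ℝ}
    (hA : ∀ n, ‖A n‖ ≤ C) (n : ℕ) (u : TPow H n) :
    raise A C hA (lp.single 2 n u) = lp.single 2 (n + 1) (A n u) := by
  ext m
  cases m with
  | zero => rw [raise_apply_zero, lp.single_apply_ne _ _ _ (Nat.succ_ne_zero n).symm]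
  | succ m =>
    rw [raise_apply_succ]
    by_cases h : m = n
    · subst h; rw [lp.single_apply_self, lp.single_apply_self]
    · rw [lp.single_apply_ne _ _ _ h, lp.single_apply_ne _ _ _ (by simpa using h), map_zero]

theorem adjoint_raise_apply {A : (n : ℕ) → (TPow H n →L[ℂ] TPow H (n + 1))} {C : ℝ}
    (hA : ∀ n, ‖A n‖ ≤ C) (x : Fock H) (n : ℕ) :
    adjoint (raise A C hA) x n = adjoint (A n) (x (n + 1)) := by
  refine ext_inner_left ℂ fun u => ?_
  rw [← lp.inner_single_left, adjoint_inner_right, raise_single, lp.inner_single_left,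
    adjoint_inner_right]

theorem adjoint_raise_vacuum {A : (n : ℕ) → (TPow H n →L[ℂ] TPow H (n + 1))} {C : ℝ}
    (hA : ∀ n, ‖A n‖ ≤ C) : adjoint (raise A C hA) (vacuum H) = 0 := by
  ext n
  rw [adjoint_raise_apply, vacuum_apply_succ, map_zero]
  rfl

theorem tPow_succ_ext {X : Type*} [AddCommGroup X] [Module ℂ X] {n : ℕ}
    {F G : TPow H (n + 1) →ₗ[ℂ] X}
    (h : ∀ (f : H) (u : TPow H n), F (leftTensor f n u) = G (leftTensor f n u)) : F = G :=
  TensorProduct.ext' (M := H) (N := TPow H n) h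

theorem leftTensor_smul (c : ℂ) (f : H) (n : ℕ) : leftTensor (c • f) n = c • leftTensor f n :=
  map_smul (TensorProduct.mkL ℂ H (TPow H n)) c f

theorem leftTensor_sum {ι : Type*} (t : Finset ι) (f : ι → H) (n : ℕ) :
    leftTensor (∑ i ∈ t, f i) n = ∑ i ∈ t, leftTensor (f i) n :=
  map_sum (TensorProduct.mkL ℂ H (TPow H n)) f t

theorem inner_leftTensor (f g : H) (n : ℕ) (u v : TPow H n) :
    ⟪leftTensor f n u, leftTensor g n v⟫_ℂ = ⟪f, g⟫_ℂ * ⟪u, v⟫_ℂ :=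
  TensorProduct.inner_tmul (𝕜 := ℂ) f g u v

theorem adjoint_leftTensor (f g : H) (n : ℕ) (u : TPow H n) :
    adjoint (leftTensor f n) (leftTensor g n u) = ⟪f, g⟫_ℂ • u :=
  ext_inner_left ℂ fun v => by
    rw [adjoint_inner_right, inner_leftTensor, inner_smul_right]

theorem rightTensor_succ_leftTensor (f g : H) (n : ℕ) (u : TPow H n) :
    rightTensor f (n + 1) (leftTensor g n u) = leftTensor g (n + 1) (rightTensor f n u) := rfl

theorem adjoint_rightTensor_succ_leftTensor (f g : H) (n : ℕ) (u : TPow H (n + 1)) :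
    adjoint (rightTensor f (n + 1)) (leftTensor g (n + 1) u) =
      leftTensor g n (adjoint (rightTensor f n) u) :=
  congrArg (fun A : H ⊗[ℂ] TPow H (n + 1) →L[ℂ] H ⊗[ℂ] TPow H n => A (g ⊗ₜ[ℂ] u))
    (ContinuousLinearMap.adjoint_lTensor (E := H) (g := rightTensor f n))

theorem adjoint_rightTensor (f g : H) (n : ℕ) (u : TPow H n) :
    adjoint (rightTensor f n) (rightTensor g n u) = ⟪f, g⟫_ℂ • u := by
  induction n with
  | zero => exact adjoint_leftTensor f g 0 u
  | succ n ih =>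
    refine LinearMap.congr_fun (tPow_succ_ext (F := ((adjoint (rightTensor f (n + 1))).comp
      (rightTensor g (n + 1)) : TPow H (n + 1) →L[ℂ] TPow H (n + 1)).toLinearMap)
      (G := ⟪f, g⟫_ℂ • LinearMap.id) fun h u => ?_) u
    change adjoint (rightTensor f (n + 1)) (rightTensor g (n + 1) (leftTensor h n u)) =
      ⟪f, g⟫_ℂ • leftTensor h n u
    rw [rightTensor_succ_leftTensor, adjoint_rightTensor_succ_leftTensor, ih, map_smul]

variable {d : ℕ} (e : OrthonormalBasis (Fin d) ℂ H)

/-- Resolution of the identity `∑ r_i r_i^* = 1` off the vacuum: in degree `1` it is the basis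
expansion, and in higher degrees the leftmost factor passes through. -/
theorem sum_rightTensor_adjoint (n : ℕ) (u : TPow H (n + 1)) :
    ∑ i, rightTensor (e i) n (adjoint (rightTensor (e i) n) u) = u := by
  have key : (∑ i, ((rightTensor (e i) n).comp (adjoint (rightTensor (e i) n)) :
      TPow H (n + 1) →L[ℂ] TPow H (n + 1)).toLinearMap) = LinearMap.id := by
    induction n with
    | zero =>
      refine tPow_succ_ext fun h u => ?_
      rw [LinearMap.sum_apply]
      have (i : Fin d) : rightTensor (e i) 0 (adjoint (rightTensor (e i) 0) (leftTensor h 0 u)) =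
          leftTensor (⟪e i, h⟫_ℂ • e i) 0 u := by
        change leftTensor (e i) 0 (adjoint (leftTensor (e i) 0) (leftTensor h 0 u)) = _
        rw [adjoint_leftTensor, map_smul, leftTensor_smul]
        rfl
      refine (Finset.sum_congr rfl fun i _ => this i).trans ?_
      rw [← _root_.sum_apply, ← leftTensor_sum, e.sum_repr']
      rfl
    | succ n ih =>
      refine tPow_succ_ext fun h u => ?_
      rw [LinearMap.sum_apply]
      have (i : Fin d) : rightTensor (e i) (n + 1)
          (adjoint (rightTensor (e i) (n + 1)) (leftTensor h (n + 1) u)) =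
          leftTensor h (n + 1) (rightTensor (e i) n (adjoint (rightTensor (e i) n) u)) := by
        rw [adjoint_rightTensor_succ_leftTensor, rightTensor_succ_leftTensor]
      refine (Finset.sum_congr rfl fun i _ => this i).trans ?_
      rw [← map_sum]
      have := LinearMap.congr_fun (ih u) u
      rw [LinearMap.sum_apply] at this
      exact congrArg (leftTensor h (n + 1)) this
  have := LinearMap.congr_fun key u
  rwa [LinearMap.sum_apply] at this

theorem adjoint_leftCreation_leftCreation (f g : H) (x : Fock H) :
    adjoint (leftCreation f) (leftCreation g x) = ⟪f, g⟫_ℂ • x := by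
  ext n
  exact (adjoint_raise_apply ..).trans (adjoint_leftTensor ..)

theorem rightAnnihilation_rightCreation (f g : H) (x : Fock H) :
    rightAnnihilation f (rightCreation g x) = ⟪f, g⟫_ℂ • x := by
  ext n
  exact (adjoint_raise_apply ..).trans (adjoint_rightTensor ..)

theorem rightCreation_leftCreation (f g : H) (x : Fock H) :
    rightCreation f (leftCreation g x) = leftCreation g (rightCreation f x) := by
  ext n
  match n with
  | 0 => rfl
  | 1 => exact (map_zero (rightTensor f 0)).trans (map_zero (leftTensor g 0)).symm
  | n + 2 => rfl

/-- The two operators act on opposite ends of a tensor and commute, except on the vacuum component,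
where `r(f)^*` removes the very `g` that `l(g)` has added. -/
theorem rightAnnihilation_leftCreation (f g : H) (x : Fock H) :
    rightAnnihilation f (leftCreation g x) =
      leftCreation g (rightAnnihilation f x) + ⟪f, g⟫_ℂ • ⟪vacuum H, x⟫_ℂ • vacuum H := by
  ext n
  match n with
  | 0 =>
    refine (adjoint_raise_apply ..).trans ((adjoint_leftTensor f g 0 (x 0)).trans ?_)
    rw [inner_vacuum]
    change _ = (0 : TPow H 0) + ⟪f, g⟫_ℂ • ⟪vacuumZero, x 0⟫_ℂ • (vacuum H : Fock H) 0
    rw [vacuum_apply_zero, inner_vacuumZero_smul, zero_add]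
  | n + 1 =>
    refine (adjoint_raise_apply ..).trans ?_
    change _ = leftTensor g n (rightAnnihilation f x n) +
      ⟪f, g⟫_ℂ • ⟪vacuum H, x⟫_ℂ • (vacuum H : Fock H) (n + 1)
    rw [vacuum_apply_succ, smul_zero, smul_zero, add_zero]
    exact (adjoint_rightTensor_succ_leftTensor f g n (x (n + 1))).trans
      (congrArg (leftTensor g n) (adjoint_raise_apply (norm_rightTensor_le f) x n).symm)

theorem rightAnnihilation_vacuum (f : H) : rightAnnihilation f (vacuum H) = 0 :=
  adjoint_raise_vacuum _

theorem adjoint_leftCreation_vacuum (f : H) : adjoint (leftCreation f) (vacuum H) = 0 :=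
  adjoint_raise_vacuum _

/-! ### Norms expressed through right annihilation -/

theorem sum_norm_sq_rightAnnihilation_apply (x : Fock H) (n : ℕ) :
    ∑ i, ‖rightAnnihilation (e i) x n‖ ^ 2 = ‖x (n + 1)‖ ^ 2 := by
  have (i : Fin d) : ((‖rightAnnihilation (e i) x n‖ ^ 2 : ℝ) : ℂ) =
      ⟪x (n + 1), rightTensor (e i) n (adjoint (rightTensor (e i) n) (x (n + 1)))⟫_ℂ := by
    rw [← adjoint_inner_left, inner_self_eq_norm_sq_to_K, rightAnnihilation, rightCreation,
      adjoint_raise_apply]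
    push_cast; rfl
  apply Complex.ofReal_injective
  rw [Complex.ofReal_sum]
  simp_rw [this]
  rw [← inner_sum, sum_rightTensor_adjoint, inner_self_eq_norm_sq_to_K]
  push_cast; rfl

theorem hasSum_norm_sq (x : Fock H) : HasSum (fun n => ‖x n‖ ^ 2) (‖x‖ ^ 2) := by
  have := lp.hasSum_norm (by norm_num) x
  simpa using this

theorem norm_sq_eq (x : Fock H) :
    ‖x‖ ^ 2 = ‖⟪vacuum H, x⟫_ℂ‖ ^ 2 + ∑ i, ‖rightAnnihilation (e i) x‖ ^ 2 := by
  have h0 : ‖⟪vacuum H, x⟫_ℂ‖ = ‖x 0‖ := by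
    conv_rhs => rw [← inner_vacuumZero_smul (x 0), norm_smul, norm_vacuumZero, mul_one]
    rw [inner_vacuum]
  have h1 := hasSum_sum (s := Finset.univ) fun (i : Fin d) _ =>
    hasSum_norm_sq (rightAnnihilation (e i) x)
  simp_rw [sum_norm_sq_rightAnnihilation_apply] at h1
  rw [h0]
  have := ((hasSum_nat_add_iff' 1).2 (hasSum_norm_sq x)).unique h1
  simp only [Finset.range_one, Finset.sum_singleton] at this
  linarith

/-- `∑_w ⟪R_w x, R_w y⟫` over the words `w` of length `k`. -/
def wordForm {K : Type*} [NormedAddCommGroup K] [InnerProductSpace ℂ K] (R : Fin d → K →L[ℂ] K) :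
    ℕ → K → K → ℂ
  | 0, x, y => ⟪x, y⟫_ℂ
  | k + 1, x, y => ∑ i, wordForm R k (R i x) (R i y)

/-- Each round of right annihilation lowers the degree by one without losing norm in positive
degrees, so length `k` words see exactly the tail from degree `k` on. -/
theorem wordForm_rightAnnihilation_self (k : ℕ) (x : Fock H) :
    HasSum (fun n => ((‖x (n + k)‖ ^ 2 : ℝ) : ℂ))
      (wordForm (fun i => rightAnnihilation (e i)) k x x) := by
  induction k generalizing x with
  | zero =>
    have := Complex.hasSum_ofReal.2 (hasSum_norm_sq x)
    rw [wordForm, inner_self_eq_norm_sq_to_K]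
    push_cast at this ⊢
    exact this
  | succ k ih =>
    have h1 := hasSum_sum (s := Finset.univ) fun (i : Fin d) _ => ih (rightAnnihilation (e i) x)
    simp_rw [← Complex.ofReal_sum, sum_norm_sq_rightAnnihilation_apply] at h1
    exact h1

theorem tendsto_wordForm_rightAnnihilation (x : Fock H) :
    Tendsto (fun k => wordForm (fun i => rightAnnihilation (e i)) k x x) atTop (𝓝 0) := by
  have h (k : ℕ) := (wordForm_rightAnnihilation_self e k x).tsum_eq
  simp_rw [← h]
  exact tendsto_sum_nat_add fun n => ((‖x n‖ ^ 2 : ℝ) : ℂ)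

end FreeFock

/-! ### Powers of linear pencils -/

namespace FreeFock
open Filter Topology ContinuousLinearMap
open scoped InnerProductSpace

section Generic

variable {d n : ℕ}

/-- Some power has norm below `1`, and `1 - y` is a commuting factor of `1 - y ^ k`. Only decay of
powers is needed, not `‖x‖ < 1`. -/
theorem isUnit_one_sub_smul {A : Type*} [NormedRing A] [NormedAlgebra ℂ A]
    [HasSummableGeomSeries A] {x : A} (hx : Tendsto (fun k => ‖x ^ k‖) atTop (𝓝 0)) {t : ℝ}
    (ht : t ∈ Set.Icc (0 : ℝ) 1) : IsUnit (1 - (t : ℂ) • x) := by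
  obtain ⟨k, hk⟩ := (hx.eventually_lt_const one_pos).exists
  have h : IsUnit (1 - ((t : ℂ) • x) ^ k) := by
    refine isUnit_one_sub_of_norm_lt_one (lt_of_le_of_lt ?_ hk)
    rw [smul_pow, norm_smul, norm_pow, Complex.norm_real, Real.norm_of_nonneg ht.1]
    exact mul_le_of_le_one_left (norm_nonneg _) (pow_le_one₀ ht.1 ht.2)
  rw [← mul_neg_geom_sum] at h
  refine ((Commute.isUnit_mul_iff ?_).1 h).1
  exact (mul_neg_geom_sum _ _).trans (geom_sum_mul_neg _ _).symm

/-- Here `X = (1 - N)⁻¹ (1 - M)⁻¹`, and the annihilation relations make `P` fixed by the right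
factor on its left and by the left factor on its right. -/
theorem compression_inverse {A : Type*} [Ring A] {M N P X : A} (hM : IsUnit (1 - M))
    (hN : IsUnit (1 - N)) (hMP : M * P = 0) (hPN : P * N = 0) (hP : P * P = P)
    (hX : (1 - M) * (1 - N) * X = 1) : P * X * P = P := by
  obtain ⟨m, hm⟩ := hM
  obtain ⟨k, hk⟩ := hN
  have h1 : ((m⁻¹ : Aˣ) : A) * P = P := by
    rw [Units.inv_mul_eq_iff_eq_mul, hm, sub_mul, one_mul, hMP, sub_zero]
  have h2 : P * ((k⁻¹ : Aˣ) : A) = P := by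
    rw [Units.mul_inv_eq_iff_eq_mul, hk, mul_sub, mul_one, hPN, sub_zero]
  have h3 : X = (k⁻¹ : Aˣ) * (m⁻¹ : Aˣ) := by
    rw [← hm, ← hk, ← Units.val_mul] at hX
    rw [← Units.val_mul, ← mul_inv_rev]
    exact (Units.inv_eq_of_mul_eq_one_right hX).symm
  rw [h3, ← mul_assoc, h2, mul_assoc, h1, hP]

/-- The matrix `∑ i, b i ⊗ x i`. -/
def pencil {A : Type*} [Ring A] [Algebra ℂ A] (b : Fin d → Matrix (Fin n) (Fin n) ℂ)
    (x : Fin d → A) : Matrix (Fin n) (Fin n) A :=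
  Matrix.of fun p q => ∑ i, b i p q • x i

theorem pencil_pow_succ {A : Type*} [Ring A] [Algebra ℂ A]
    (b : Fin d → Matrix (Fin n) (Fin n) ℂ) (x : Fin d → A) (k : ℕ) (α : Fin n → ℂ) (p : Fin n) :
    ∑ q, α q • (pencil b x ^ (k + 1)) p q =
      ∑ i, (∑ q, (b i).mulVec α q • (pencil b x ^ k) p q) * x i := by
  simp only [pow_succ, Matrix.mul_apply, pencil, Matrix.of_apply, Matrix.mulVec, dotProduct,
    Finset.mul_sum, Finset.sum_mul, Finset.smul_sum, Finset.sum_smul, mul_smul_comm, smul_mul_assoc,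
    smul_smul]
  rw [Finset.sum_comm]
  conv_rhs => rw [Finset.sum_comm]
  refine Finset.sum_congr rfl fun m _ => ?_
  rw [Finset.sum_comm]
  refine Finset.sum_congr rfl fun i _ => Finset.sum_congr rfl fun q _ => ?_
  rw [mul_comm]

variable {K : Type*} [NormedAddCommGroup K] [InnerProductSpace ℂ K]

/-- Iterating the norm identity inside `S` makes the word sums constantly `‖x‖²`, while they tend to
`0`. -/
theorem eq_zero_of_norm_sq_eq_sum {R : Fin d → K →L[ℂ] K}
    (hR : ∀ x, Tendsto (fun k => wordForm R k x x) atTop (𝓝 0)) {S : Set K}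
    (hS : ∀ x ∈ S, ∀ i, R i x ∈ S) (hn : ∀ x ∈ S, ‖x‖ ^ 2 = ∑ i, ‖R i x‖ ^ 2) {x : K}
    (hx : x ∈ S) : x = 0 := by
  have h (k : ℕ) : ∀ x ∈ S, wordForm R k x x = ((‖x‖ ^ 2 : ℝ) : ℂ) := by
    induction k with
    | zero => intro x _; rw [wordForm, inner_self_eq_norm_sq_to_K]; push_cast; rfl
    | succ k ih =>
      intro x hx
      rw [wordForm, hn x hx, Complex.ofReal_sum]
      exact Finset.sum_congr rfl fun i _ => ih _ (hS x hx i)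
  have h1 := hR x
  simp_rw [fun k => h k x hx] at h1
  have h2 := tendsto_nhds_unique h1 tendsto_const_nhds
  have h3 : ‖x‖ ^ 2 = 0 := by exact_mod_cast h2.symm
  simpa using h3

/-! ### Decay of the powers of a pencil -/

variable {R : Fin d → K →L[ℂ] K} {v : Fin n → K} {b : Fin d → Matrix (Fin n) (Fin n) ℂ}

theorem map_sum_smul_eq_mulVec (hRv : ∀ i q, R i (v q) = ∑ m, b i m q • v m) (i : Fin d)
    (α : Fin n → ℂ) : R i (∑ q, α q • v q) = ∑ m, (b i).mulVec α m • v m := by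
  simp only [map_sum, map_smul, hRv, Finset.smul_sum, smul_smul, Matrix.mulVec, dotProduct,
    Finset.sum_smul]
  rw [Finset.sum_comm]
  simp_rw [mul_comm]

variable [CompleteSpace K] {l : Fin d → K →L[ℂ] K}

/-- Peeling off the last factor replaces `α` by `b_i α`, which is the action of `R i` on `∑ α_q
v_q`; the relation `l_i^* l_j = δ_ij` leaves only diagonal terms. -/
theorem sum_star_pow_pencil_mul (hl : ∀ i j, star (l i) * l j = if i = j then 1 else 0)
    (hv : Orthonormal ℂ v) (hRv : ∀ i q, R i (v q) = ∑ m, b i m q • v m) (k : ℕ)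
    (α β : Fin n → ℂ) :
    ∑ p, star (∑ q, α q • (pencil b l ^ k) p q) * (∑ q, β q • (pencil b l ^ k) p q) =
      wordForm R k (∑ q, α q • v q) (∑ q, β q • v q) • (1 : K →L[ℂ] K) := by
  induction k generalizing α β with
  | zero =>
    simp [wordForm, hv.inner_sum, Matrix.one_apply, Finset.sum_smul, smul_smul, mul_comm]
  | succ k ih =>
    simp_rw [pencil_pow_succ, wordForm, map_sum_smul_eq_mulVec hRv, Finset.sum_smul]
    obtain ⟨E, hE⟩ : ∃ E : (Fin n → ℂ) → Fin n → K →L[ℂ] K,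
      ∀ γ p, ∑ q, γ q • (pencil b l ^ k) p q = E γ p := ⟨_, fun _ _ => rfl⟩
    simp_rw [hE] at ih ⊢
    simp only [star_sum, star_mul, Finset.sum_mul_sum]
    rw [Finset.sum_comm]
    refine Finset.sum_congr rfl fun i _ => ?_
    have h (j : Fin d) : ∑ p, star (l i) * star (E ((b i).mulVec α) p) *
        (E ((b j).mulVec β) p * l j) = wordForm R k (∑ q, (b i).mulVec α q • v q)
          (∑ q, (b j).mulVec β q • v q) • (star (l i) * l j) := by
      calc _ = star (l i) * (∑ p, star (E ((b i).mulVec α) p) * E ((b j).mulVec β) p) * l j := by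
            rw [Finset.mul_sum, Finset.sum_mul]; simp only [mul_assoc]
        _ = _ := by rw [ih, mul_smul_comm, mul_one, smul_mul_assoc]
    rw [Finset.sum_comm, Finset.sum_congr rfl fun j _ => h j]
    simp [hl]

theorem sum_pow_pencil_mul_star (hl : ∀ i j, star (l i) * l j = if i = j then 1 else 0)
    (hv : Orthonormal ℂ v) (hRv : ∀ i q, R i (v q) = ∑ m, b i m q • v m) (k : ℕ)
    (α β : Fin n → ℂ) :
    ∑ p, (∑ q, α q • (pencil b (star l) ^ k) p q) * star (∑ q, β q • (pencil b (star l) ^ k) p q) =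
      wordForm R k (∑ q, β q • v q) (∑ q, α q • v q) • (1 : K →L[ℂ] K) := by
  induction k generalizing α β with
  | zero =>
    simp [wordForm, hv.inner_sum, Matrix.one_apply, Finset.sum_smul, smul_smul, mul_comm]
  | succ k ih =>
    simp_rw [pencil_pow_succ, wordForm, map_sum_smul_eq_mulVec hRv, Finset.sum_smul, ← ih]
    rw [Finset.sum_comm]
    refine Finset.sum_congr rfl fun p _ => ?_
    rw [star_sum, Finset.sum_mul_sum]
    refine Finset.sum_congr rfl fun i _ => ?_
    rw [Finset.sum_eq_single i]
    · rw [star_mul, mul_assoc, ← mul_assoc (star l i), Pi.star_apply, star_star, hl, if_pos rfl,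
        one_mul]
    · intro j _ hj
      rw [star_mul, mul_assoc, ← mul_assoc (star l i), Pi.star_apply, Pi.star_apply, star_star, hl,
        if_neg hj.symm, zero_mul, mul_zero]
    · simp

theorem norm_sq_le_of_sum_star_mul {ι : Type*} [Fintype ι] {y : ι → K →L[ℂ] K} {c : ℂ}
    (h : ∑ p, star (y p) * y p = c • (1 : K →L[ℂ] K)) (p : ι) : ‖y p‖ ^ 2 ≤ ‖c‖ := by
  have h1 (x : K) : ‖y p x‖ ^ 2 ≤ ‖c‖ * ‖x‖ ^ 2 := by
    have h2 : ∑ p, ((‖y p x‖ ^ 2 : ℝ) : ℂ) = c * ((‖x‖ ^ 2 : ℝ) : ℂ) := by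
      have := congrArg (fun T : K →L[ℂ] K => ⟪x, T x⟫_ℂ) h
      simp only [_root_.sum_apply, inner_sum, mul_apply_eq_comp, star_eq_adjoint,
        adjoint_inner_right, _root_.smul_apply, one_apply_eq_self,
        inner_smul_right, inner_self_eq_norm_sq_to_K] at this
      push_cast
      exact this
    have h3 : ∑ p, ‖y p x‖ ^ 2 = ‖c‖ * ‖x‖ ^ 2 := by
      have := congrArg norm h2
      rw [← Complex.ofReal_sum, norm_mul, Complex.norm_real, Complex.norm_real,
        Real.norm_of_nonneg (by positivity), Real.norm_of_nonneg (by positivity)] at this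
      exact this
    rw [← h3]
    exact Finset.single_le_sum (f := fun p => ‖y p x‖ ^ 2) (fun _ _ => by positivity)
      (Finset.mem_univ p)
  have h4 : ‖y p‖ ≤ √‖c‖ := by
    refine opNorm_le_bound _ (Real.sqrt_nonneg _) fun x => ?_
    refine le_of_sq_le_sq ?_ (by positivity)
    rw [mul_pow, Real.sq_sqrt (norm_nonneg _)]
    exact h1 x
  calc _ ≤ √‖c‖ ^ 2 := by gcongr
    _ = _ := Real.sq_sqrt (norm_nonneg _)

attribute [local instance] Matrix.linftyOpNormedRing Matrix.linftyOpNormedAlgebra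
  Matrix.linftyOpNormedAddCommGroup

theorem tendsto_norm_matrix {K : Type*} [NormedAddCommGroup K] [InnerProductSpace ℂ K]
    {Q : ℕ → Matrix (Fin n) (Fin n) (K →L[ℂ] K)} {c : ℕ → Fin n → ℂ}
    (hQ : ∀ k p q, ‖Q k p q‖ ^ 2 ≤ ‖c k q‖) (hc : ∀ q, Tendsto (fun k => c k q) atTop (𝓝 0)) :
    Tendsto (fun k => ‖Q k‖) atTop (𝓝 0) := by
  have h (p q : Fin n) : Tendsto (fun k => ‖Q k p q‖) atTop (𝓝 0) := by
    have h1 : Tendsto (fun k => √‖c k q‖) atTop (𝓝 0) := by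
      simpa using (hc q).norm.sqrt
    exact squeeze_zero (fun _ => norm_nonneg _) (fun k => Real.le_sqrt_of_sq_le (hQ k p q)) h1
  refine squeeze_zero (fun _ => norm_nonneg _) (fun k => norm_matrix_le_sum _) ?_
  simpa using tendsto_finsetSum Finset.univ fun p _ =>
    tendsto_finsetSum Finset.univ fun q _ => h p q

theorem tendsto_norm_pow_pencil (hR : ∀ x, Tendsto (fun k => wordForm R k x x) atTop (𝓝 0))
    (hl : ∀ i j, star (l i) * l j = if i = j then 1 else 0)
    (hv : Orthonormal ℂ v) (hRv : ∀ i q, R i (v q) = ∑ m, b i m q • v m) :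
    Tendsto (fun k => ‖pencil b l ^ k‖) atTop (𝓝 0) := by
  refine tendsto_norm_matrix (c := fun k q => wordForm R k (v q) (v q)) (fun k p q => ?_)
    fun q => hR (v q)
  -- Unit coefficient vectors isolate column `q`, so all its entries are bounded by the word sum of
  -- `v q`.
  have := norm_sq_le_of_sum_star_mul
    (sum_star_pow_pencil_mul hl hv hRv k (Pi.single q 1) (Pi.single q 1)) p
  simpa [Pi.single_apply] using this

theorem tendsto_norm_pow_pencil_star
    (hR : ∀ x, Tendsto (fun k => wordForm R k x x) atTop (𝓝 0))
    (hl : ∀ i j, star (l i) * l j = if i = j then 1 else 0)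
    (hv : Orthonormal ℂ v) (hRv : ∀ i q, R i (v q) = ∑ m, b i m q • v m) :
    Tendsto (fun k => ‖pencil b (star l) ^ k‖) atTop (𝓝 0) := by
  refine tendsto_norm_matrix (c := fun k q => wordForm R k (v q) (v q)) (fun k p q => ?_)
    fun q => hR (v q)
  have := norm_sq_le_of_sum_star_mul (y := fun p => star (∑ q', (Pi.single q 1 : Fin n → ℂ) q' •
      (pencil b (star l) ^ k) p q')) ((Finset.sum_congr rfl fun p _ => by rw [star_star]).trans
    (sum_pow_pencil_mul_star hl hv hRv k (Pi.single q 1) (Pi.single q 1))) p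
  simpa [Pi.single_apply] using this

/-- The quadratic term of the factored pencil is a scalar matrix; this is why the product is affine
in the `s_i`. -/
theorem pencil_star_mul_pencil (hl : ∀ i j, star (l i) * l j = if i = j then 1 else 0) :
    pencil b (star l) * pencil b l = (∑ i, b i * b i).map (algebraMap ℂ (K →L[ℂ] K)) := by
  ext1 p q
  simp only [Matrix.mul_apply, pencil, Matrix.of_apply, Finset.sum_mul_sum, Matrix.map_apply,
    Matrix.sum_apply, Pi.star_apply, smul_mul_smul_comm, hl, map_sum, smul_ite, smul_zero,
    Finset.sum_ite_eq, Finset.mem_univ, if_true, ← Algebra.algebraMap_eq_smul_one]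
  exact Finset.sum_comm

end Generic

end FreeFock

/-! ### Commutation relations and the vacuum vector -/

namespace FreeFock
open Filter Topology ContinuousLinearMap
open scoped InnerProductSpace

variable {H : Type u} [NormedAddCommGroup H] [InnerProductSpace ℂ H] [FiniteDimensional ℂ H]
  {d : ℕ} (e : OrthonormalBasis (Fin d) ℂ H)

variable (H) in
/-- The orthogonal projection onto `ℂ Ω`. -/
def vacuumProj : Fock H →L[ℂ] Fock H := (innerSL ℂ (vacuum H)).smulRight (vacuum H)

theorem vacuumProj_apply (x : Fock H) : vacuumProj H x = ⟪vacuum H, x⟫_ℂ • vacuum H := rfl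

theorem inner_vacuum_self : ⟪vacuum H, vacuum H⟫_ℂ = 1 := by
  rw [inner_self_eq_norm_sq_to_K, norm_vacuum]; simp

theorem vacuum_ne_zero : vacuum H ≠ 0 := by
  rw [← norm_ne_zero_iff, norm_vacuum]; exact one_ne_zero

instance nontrivial_fock : Nontrivial (Fock H) := ⟨⟨_, _, vacuum_ne_zero⟩⟩

theorem vacuumProj_vacuum : vacuumProj H (vacuum H) = vacuum H := by
  rw [vacuumProj_apply, inner_vacuum_self, one_smul]

theorem vacuumProj_mul_self : vacuumProj H * vacuumProj H = vacuumProj H := by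
  ext1 x
  rw [mul_apply_eq_comp, vacuumProj_apply x, map_smul, vacuumProj_vacuum]

theorem star_vacuumProj : star (vacuumProj H) = vacuumProj H := by
  rw [star_eq_adjoint]
  refine ((eq_adjoint_iff _ _).2 fun x y => ?_).symm
  rw [vacuumProj_apply, vacuumProj_apply, inner_smul_left, inner_smul_right, inner_conj_symm]
  ring

theorem star_leftCreation_mul (i j : Fin d) :
    star (leftCreation (e i)) * leftCreation (e j) = if i = j then 1 else 0 := by
  ext1 x
  rw [mul_apply_eq_comp, star_eq_adjoint, adjoint_leftCreation_leftCreation,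
    e.inner_eq_ite]
  split_ifs <;> simp

theorem rightAnnihilation_mul_rightCreation (i j : Fin d) :
    rightAnnihilation (e i) * rightCreation (e j) = if i = j then 1 else 0 := by
  ext1 x
  rw [mul_apply_eq_comp, rightAnnihilation_rightCreation, e.inner_eq_ite]
  split_ifs <;> simp

theorem star_leftCreation_mul_vacuumProj (f : H) : star (leftCreation f) * vacuumProj H = 0 := by
  ext1 x
  rw [mul_apply_eq_comp, vacuumProj_apply, map_smul, star_eq_adjoint, adjoint_leftCreation_vacuum,
    smul_zero]
  rfl

theorem vacuumProj_mul_leftCreation (f : H) : vacuumProj H * leftCreation f = 0 := by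
  apply star_injective
  rw [star_mul, star_vacuumProj, star_leftCreation_mul_vacuumProj, star_zero]

theorem rightAnnihilation_mul_vacuumProj (f : H) : rightAnnihilation f * vacuumProj H = 0 := by
  ext1 x
  rw [mul_apply_eq_comp, vacuumProj_apply, map_smul, rightAnnihilation_vacuum, smul_zero]
  rfl

theorem star_semicircular (i : Fin d) : star (semicircular e i) = semicircular e i := by
  rw [semicircular, ← star_eq_adjoint, star_add, star_star, add_comm]

theorem rightAnnihilation_commutator_semicircular (i j : Fin d) :
    rightAnnihilation (e i) * semicircular e j - semicircular e j * rightAnnihilation (e i) =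
      if i = j then vacuumProj H else 0 := by
  have h1 : rightAnnihilation (e i) * leftCreation (e j) =
      leftCreation (e j) * rightAnnihilation (e i) + if i = j then vacuumProj H else 0 := by
    ext1 x
    rw [mul_apply_eq_comp, rightAnnihilation_leftCreation, e.inner_eq_ite]
    split_ifs <;> simp [vacuumProj_apply]
  have h2 : rightAnnihilation (e i) * star (leftCreation (e j)) =
      star (leftCreation (e j)) * rightAnnihilation (e i) := by
    have : rightCreation (e i) * leftCreation (e j) = leftCreation (e j) * rightCreation (e i) := by
      ext1 x
      exact rightCreation_leftCreation _ _ x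
    rw [rightAnnihilation, ← star_eq_adjoint, ← star_mul, ← star_mul, this]
  rw [semicircular, ← star_eq_adjoint, mul_add, add_mul, h1, h2]
  abel

/-- The right semicircular operators `r_i + r_i^*` commute with the left ones. -/
theorem semicircular_mul_right (i j : Fin d) :
    semicircular e j * (rightCreation (e i) + rightAnnihilation (e i)) =
      (rightCreation (e i) + rightAnnihilation (e i)) * semicircular e j := by
  have h1 := rightAnnihilation_commutator_semicircular e i j
  have h2 := congrArg star h1
  rw [star_sub, star_mul, star_mul, star_semicircular, rightAnnihilation, star_eq_adjoint,
    adjoint_adjoint, apply_ite star, star_vacuumProj, star_zero, ← h1] at h2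
  rw [mul_add, add_mul, rightAnnihilation, ← sub_eq_zero]
  rw [rightAnnihilation, ← sub_eq_zero] at h2
  rw [← h2]
  abel

/-! ### Commutants and the separating vacuum vector -/

theorem mem_LInf {x : Fock H →L[ℂ] Fock H} :
    x ∈ LInf e ↔ ∀ y, (∀ j, semicircular e j * y = y * semicircular e j) → y * x = x * y := by
  have hc (y : Fock H →L[ℂ] Fock H) :
      y ∈ StarSubalgebra.centralizer ℂ (Set.range (semicircular e)) ↔
        ∀ j, semicircular e j * y = y * semicircular e j := by
    rw [StarSubalgebra.mem_centralizer_iff, Set.forall_mem_range]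
    simp [star_semicircular]
  change x ∈ StarSubalgebra.centralizer ℂ
    (StarSubalgebra.centralizer ℂ (Set.range (semicircular e)) : Set _) ↔ _
  rw [StarSubalgebra.mem_centralizer_iff]
  constructor
  · exact fun h y hy => (h y ((hc y).2 hy)).1
  · intro h y hy
    exact ⟨h y ((hc y).1 hy), h _ ((hc _).1 (star_mem hy))⟩

theorem right_mul_comm_of_mem_LInf {a : Fock H →L[ℂ] Fock H} (ha : a ∈ LInf e) (i : Fin d) :
    (rightCreation (e i) + rightAnnihilation (e i)) * a =
      a * (rightCreation (e i) + rightAnnihilation (e i)) :=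
  (mem_LInf e).1 ha _ fun j => semicircular_mul_right e i j

theorem inv_mem_LInf {x : (Fock H →L[ℂ] Fock H)ˣ} (hx : (x : Fock H →L[ℂ] Fock H) ∈ LInf e) :
    ((x⁻¹ : (Fock H →L[ℂ] Fock H)ˣ) : Fock H →L[ℂ] Fock H) ∈ LInf e :=
  (mem_LInf e).2 fun y hy =>
    Commute.units_inv_right (show Commute y (x : Fock H →L[ℂ] Fock H) from (mem_LInf e).1 hx y hy)

/-- Uniqueness principle: without vacuum components, `norm_sq_eq` loses nothing at any stage of
right annihilation. -/
theorem eq_zero_of_orthogonal_vacuum {S : Set (Fock H)}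
    (hS : ∀ x ∈ S, ∀ i, rightAnnihilation (e i) x ∈ S) (hΩ : ∀ x ∈ S, ⟪vacuum H, x⟫_ℂ = 0)
    {x : Fock H} (hx : x ∈ S) : x = 0 :=
  eq_zero_of_norm_sq_eq_sum (tendsto_wordForm_rightAnnihilation e) hS
    (fun x hx => by rw [norm_sq_eq e x, hΩ x hx]; simp) hx

/-- The vacuum vector is separating for `L^∞(s)`. -/
theorem eq_zero_of_apply_vacuum_eq_zero {x : Fock H →L[ℂ] Fock H} (hx : x ∈ LInf e)
    (h : x (vacuum H) = 0) : x = 0 := by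
  set word : List (Fin d) → Fock H :=
    fun w => w.foldr (fun i => rightCreation (e i)) (vacuum H) with hword
  have hcons (i : Fin d) (w : List (Fin d)) : word (i :: w) = rightCreation (e i) (word w) := rfl
  have hann (i : Fin d) (w : List (Fin d)) :
      rightAnnihilation (e i) (word w) = 0 ∨ rightAnnihilation (e i) (word w) = word w.tail := by
    cases w with
    | nil => exact Or.inl (rightAnnihilation_vacuum _)
    | cons j w =>
      rw [hcons, rightAnnihilation_rightCreation, e.inner_eq_ite]
      split_ifs <;> simp
  -- Since `x r_i = (r_i + r_i^*) x - x r_i^*` and `r_i^*` may shorten the word, the induction must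
  -- carry the tail as well.
  have hker (w : List (Fin d)) : x (word w) = 0 ∧ x (word w.tail) = 0 := by
    induction w with
    | nil => exact ⟨h, h⟩
    | cons i w ih =>
      refine ⟨?_, ih.1⟩
      have h1 := DFunLike.congr_fun (right_mul_comm_of_mem_LInf e hx i) (word w)
      have h2 : x (rightAnnihilation (e i) (word w)) = 0 := by
        rcases hann i w with h2 | h2
        · rw [h2, map_zero]
        · rw [h2, ih.2]
      simp only [mul_apply_eq_comp, _root_.add_apply, ih.1, map_zero, map_add, add_zero, h2] at h1
      rw [hcons, ← h1]
  have hdense : (Submodule.span ℂ (Set.range word))ᗮ = ⊥ := by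
    rw [Submodule.eq_bot_iff]
    intro y hy
    refine eq_zero_of_orthogonal_vacuum e (S := {y | ∀ w, ⟪word w, y⟫_ℂ = 0})
      (fun y hy i w => ?_) (fun y hy => hy []) fun w =>
        (Submodule.mem_orthogonal _ _).1 hy _ (Submodule.subset_span ⟨w, rfl⟩)
    rw [rightAnnihilation, adjoint_inner_right]
    exact hy (i :: w)
  have hle : Submodule.span ℂ (Set.range word) ≤ LinearMap.ker (x : Fock H →ₗ[ℂ] Fock H) :=
    Submodule.span_le.2 (by rintro _ ⟨w, rfl⟩; exact (hker w).1)
  ext1 y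
  have htop := (Submodule.topologicalClosure_eq_top_iff).2 hdense
  have hy : y ∈ (Submodule.span ℂ (Set.range word)).topologicalClosure := htop ▸ Submodule.mem_top
  exact Submodule.topologicalClosure_minimal _ hle x.isClosed_ker hy

/-- If `a ∈ L^∞(s)` has finite rank commutators with all `r_i^*`, then `a Ω` lies in a finite
dimensional subspace which is invariant under all `r_i^*`. -/
theorem exists_finiteDimensional_invariant {a : Fock H →L[ℂ] Fock H} (ha : a ∈ LInf e)
    (hfin : ∀ i, IsFiniteRank (rightAnnihilation (e i) * a - a * rightAnnihilation (e i))) :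
    ∃ V : Submodule ℂ (Fock H), FiniteDimensional ℂ V ∧ a (vacuum H) ∈ V ∧
      ∀ i, ∀ x ∈ V, rightAnnihilation (e i) x ∈ V := by
  set T : Fin d → Fock H →L[ℂ] Fock H :=
    fun i => rightAnnihilation (e i) * a - a * rightAnnihilation (e i) with hT
  have hT' (i : Fin d) : T i = a * rightCreation (e i) - rightCreation (e i) * a := by
    have := right_mul_comm_of_mem_LInf e ha i
    rw [add_mul, mul_add] at this
    rw [hT, sub_eq_sub_iff_add_eq_add, add_comm, this]
  -- Use the form `[a, r_j]` on the left and `[r_i^*, a]` on the right; both sides become `r_i^* a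
  -- r_j - δ_ij a`. So `r_i^*` sends the range of `T j` into that of `T i`.
  have hTr (i j : Fin d) : rightAnnihilation (e i) * T j = T i * rightCreation (e j) := by
    rw [hT' j, hT]
    simp only [mul_sub, sub_mul, mul_assoc]
    rw [rightAnnihilation_mul_rightCreation, ← mul_assoc _ _ a, rightAnnihilation_mul_rightCreation]
    split_ifs <;> simp
  have hfin' (i : Fin d) : FiniteDimensional ℂ (LinearMap.range (T i : Fock H →ₗ[ℂ] Fock H)) :=
    hfin i
  refine ⟨(⨆ i, LinearMap.range (T i : Fock H →ₗ[ℂ] Fock H)) ⊔ Submodule.span ℂ {a (vacuum H)},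
    inferInstance, Submodule.mem_sup_right (Submodule.mem_span_singleton_self _), fun i x hx => ?_⟩
  suffices h : (⨆ i, LinearMap.range (T i : Fock H →ₗ[ℂ] Fock H)) ⊔
      Submodule.span ℂ {a (vacuum H)} ≤
      (⨆ i, LinearMap.range (T i : Fock H →ₗ[ℂ] Fock H)).comap
        (rightAnnihilation (e i) : Fock H →ₗ[ℂ] Fock H) from Submodule.mem_sup_left (h hx)
  refine sup_le (iSup_le fun j => ?_) (Submodule.span_le.2 (Set.singleton_subset_iff.2 ?_))
  · rintro _ ⟨y, rfl⟩
    exact Submodule.mem_iSup_of_mem i ⟨rightCreation (e j) y, (DFunLike.congr_fun (hTr i j) y).symm⟩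
  · refine Submodule.mem_iSup_of_mem i ⟨vacuum H, ?_⟩
    change rightAnnihilation (e i) (a (vacuum H)) - a (rightAnnihilation (e i) (vacuum H)) = _
    rw [rightAnnihilation_vacuum, map_zero, sub_zero]
    rfl

end FreeFock

/-! ### Realizations of elements with finite rank commutators -/

namespace FreeFock
open Filter Topology ContinuousLinearMap
open scoped InnerProductSpace

variable {H : Type u} [NormedAddCommGroup H] [InnerProductSpace ℂ H] [FiniteDimensional ℂ H]
  {d : ℕ} (e : OrthonormalBasis (Fin d) ℂ H)

section Realization

variable {n : ℕ} {v : Fin n → Fock H} {b : Fin d → Matrix (Fin n) (Fin n) ℂ}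

/-- The linear matrix pencil `(1 - ∑ b_i ⊗ l_i^*) (1 - ∑ b_i ⊗ l_i)`. -/
def linearPencil (b : Fin d → Matrix (Fin n) (Fin n) ℂ) :
    Matrix (Fin n) (Fin n) (Fock H →L[ℂ] Fock H) :=
  (1 - pencil b (star fun i => leftCreation (e i))) * (1 - pencil b fun i => leftCreation (e i))

theorem linearPencil_smul_apply (t : ℂ) :
    (1 - t • pencil b (star fun i => leftCreation (e i))) *
      (1 - t • pencil b fun i => leftCreation (e i)) =
      1 - t • pencil b (semicircular e) +
        (t ^ 2) • (∑ i, b i * b i).map (algebraMap ℂ (Fock H →L[ℂ] Fock H)) := by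
  have h : pencil b (semicircular e) =
      pencil b (fun i => leftCreation (e i)) + pencil b (star fun i => leftCreation (e i)) := by
    ext1 p q
    simp only [pencil, Matrix.add_apply, Matrix.of_apply, ← Finset.sum_add_distrib, ← smul_add]
    rfl
  rw [← pencil_star_mul_pencil (l := fun i => leftCreation (e i)) (star_leftCreation_mul e), h,
    sub_mul, one_mul, mul_sub, mul_one, smul_mul_smul_comm, smul_add, sq]
  abel

theorem linearPencil_eq : linearPencil e b = 1 - pencil b (semicircular e) +
    (∑ i, b i * b i).map (algebraMap ℂ (Fock H →L[ℂ] Fock H)) := by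
  simpa [linearPencil] using linearPencil_smul_apply e (b := b) 1

attribute [local instance] Matrix.linftyOpNormedRing Matrix.linftyOpNormedAlgebra
  Matrix.linftyOpNormedAddCommGroup

theorem isUnit_one_sub_smul_pencil (hv : Orthonormal ℂ v)
    (hRv : ∀ i q, rightAnnihilation (e i) (v q) = ∑ m, b i m q • v m) {t : ℝ}
    (ht : t ∈ Set.Icc (0 : ℝ) 1) :
    IsUnit (1 - (t : ℂ) • pencil b (star fun i => leftCreation (e i))) ∧
      IsUnit (1 - (t : ℂ) • pencil b fun i => leftCreation (e i)) := by
  have := hasSummableGeomSeries_matrix (B := Fock H →L[ℂ] Fock H) n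
  exact ⟨isUnit_one_sub_smul (tendsto_norm_pow_pencil_star
    (tendsto_wordForm_rightAnnihilation e) (star_leftCreation_mul e) hv hRv) ht,
    isUnit_one_sub_smul (tendsto_norm_pow_pencil
    (tendsto_wordForm_rightAnnihilation e) (star_leftCreation_mul e) hv hRv) ht⟩

theorem isUnit_linearPencil (hv : Orthonormal ℂ v)
    (hRv : ∀ i q, rightAnnihilation (e i) (v q) = ∑ m, b i m q • v m) :
    IsUnit (linearPencil e b) := by
  have h := isUnit_one_sub_smul_pencil e hv hRv (t := 1) (Set.right_mem_Icc.2 zero_le_one)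
  rw [Complex.ofReal_one, one_smul, one_smul] at h
  exact h.1.mul h.2

theorem inverse_linearPencil_mem {C : Subalgebra ℂ (Fock H →L[ℂ] Fock H)} (hC : IsNearOneClosed C)
    (hs : ∀ i, semicircular e i ∈ C) (hv : Orthonormal ℂ v)
    (hRv : ∀ i q, rightAnnihilation (e i) (v q) = ∑ m, b i m q • v m) (p q : Fin n) :
    Ring.inverse (linearPencil e b) p q ∈ C := by
  set T : ℝ → Matrix (Fin n) (Fin n) (Fock H →L[ℂ] Fock H) := fun t =>
    (1 - (t : ℂ) • pencil b (star fun i => leftCreation (e i))) *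
      (1 - (t : ℂ) • pencil b fun i => leftCreation (e i)) with hT
  have h1 : T 1 = linearPencil e b := by
    rw [hT, linearPencil]; simp
  rw [← h1]
  refine hC.inverse_path_mem T ?_ (by
    simp only [hT, Complex.ofReal_zero]
    rw [zero_smul, zero_smul, sub_zero, mul_one]) (fun t p q => ?_) (fun t ht => ?_) p q
  · have h (Q : Matrix (Fin n) (Fin n) (Fock H →L[ℂ] Fock H)) :
        Continuous fun t : ℝ => 1 - (t : ℂ) • Q :=
      continuous_const.sub (Complex.continuous_ofReal.smul continuous_const)
    exact (h _).mul (h _)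
  · rw [hT]
    simp only [linearPencil_smul_apply]
    have h1 : pencil b (semicircular e) p q ∈ C := by
      rw [pencil, Matrix.of_apply]
      exact C.sum_mem fun i _ => C.smul_mem (hs i) _
    refine C.add_mem (C.sub_mem ?_ (C.smul_mem h1 _)) (C.smul_mem (C.algebraMap_mem _) _)
    rw [Matrix.one_apply]
    split_ifs
    exacts [C.one_mem, C.zero_mem]
  · have h := isUnit_one_sub_smul_pencil e hv hRv ht
    exact h.1.mul h.2

/-- These are the initial values and the recursion that determine `(L⁻¹)_{pq} Ω`. The first come
from `l_i^* Ω = 0` via `compression_inverse`, the second from commuting `r_i^*` past the affine form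
of `L`. -/
theorem linearPencil_vacuum (hv : Orthonormal ℂ v)
    (hRv : ∀ i q, rightAnnihilation (e i) (v q) = ∑ m, b i m q • v m) :
    (∀ p q, ⟪vacuum H, Ring.inverse (linearPencil e b) p q (vacuum H)⟫_ℂ = if p = q then 1 else 0) ∧
    ∀ i p q, rightAnnihilation (e i) (Ring.inverse (linearPencil e b) p q (vacuum H)) =
      ∑ m, b i m q • Ring.inverse (linearPencil e b) p m (vacuum H) := by
  set X := Ring.inverse (linearPencil e b) with hXdef
  have hu := isUnit_linearPencil e hv hRv
  have hTX : linearPencil e b * X = 1 := Ring.mul_inverse_cancel _ hu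
  have hXT : X * linearPencil e b = 1 := Ring.inverse_mul_cancel _ hu
  set P : Matrix (Fin n) (Fin n) (Fock H →L[ℂ] Fock H) := Matrix.diagonal fun _ => vacuumProj H
    with hPdef
  have hPXP : P * X * P = P := by
    have h := isUnit_one_sub_smul_pencil e hv hRv (t := 1) (Set.right_mem_Icc.2 zero_le_one)
    rw [Complex.ofReal_one, one_smul, one_smul] at h
    refine compression_inverse h.1 h.2 ?_ ?_ ?_ hTX
    · ext1 p q
      simp [hPdef, pencil, Finset.sum_mul, star_leftCreation_mul_vacuumProj]
    · ext1 p q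
      simp [hPdef, pencil, Finset.mul_sum, vacuumProj_mul_leftCreation]
    · rw [hPdef, Matrix.diagonal_mul_diagonal, vacuumProj_mul_self]
  have hPXP' (p q : Fin n) : vacuumProj H * X p q * vacuumProj H =
      if p = q then vacuumProj H else 0 := by
    have := congrFun (congrFun hPXP p) q
    rwa [hPdef, Matrix.mul_diagonal, Matrix.diagonal_mul, Matrix.diagonal_apply] at this
  refine ⟨fun p q => ?_, fun i p q => ?_⟩
  · have h := congrArg (fun y => ⟪vacuum H, y⟫_ℂ) (DFunLike.congr_fun (hPXP' p q) (vacuum H))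
    simp only [mul_apply_eq_comp, vacuumProj_vacuum] at h
    rw [vacuumProj_apply, inner_smul_right, inner_vacuum_self, mul_one] at h
    rw [h]
    split_ifs
    · rw [vacuumProj_vacuum, inner_vacuum_self]
    · exact inner_zero_right _
  · set G : Matrix (Fin n) (Fin n) (Fock H →L[ℂ] Fock H) :=
      Matrix.diagonal fun _ => rightAnnihilation (e i) with hGdef
    set β : Matrix (Fin n) (Fin n) (Fock H →L[ℂ] Fock H) :=
      (b i).map (algebraMap ℂ (Fock H →L[ℂ] Fock H)) with hβ
    have hGP : G * P = 0 := by
      rw [hGdef, hPdef, Matrix.diagonal_mul_diagonal, rightAnnihilation_mul_vacuumProj,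
        Matrix.diagonal_zero]
    have hcomm : linearPencil e b * G = G * linearPencil e b + β * P := by
      rw [linearPencil_eq, ← sub_eq_iff_eq_add']
      ext1 p q
      have h1 : (pencil b (semicircular e)) p q * rightAnnihilation (e i) =
          rightAnnihilation (e i) * (pencil b (semicircular e)) p q - b i p q • vacuumProj H := by
        have h2 (j : Fin d) := sub_eq_iff_eq_add'.1 (rightAnnihilation_commutator_semicircular e i j)
        simp [pencil, Finset.sum_mul, Finset.mul_sum, h2, Finset.sum_add_distrib]
      have h3 : (1 : Matrix (Fin n) (Fin n) (Fock H →L[ℂ] Fock H)) p q * rightAnnihilation (e i) =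
          rightAnnihilation (e i) * (1 : Matrix (Fin n) (Fin n) (Fock H →L[ℂ] Fock H)) p q := by
        rw [Matrix.one_apply]; split_ifs <;> simp
      rw [hGdef, hPdef, hβ, Matrix.sub_apply, Matrix.mul_diagonal, Matrix.diagonal_mul,
        Matrix.mul_diagonal, Matrix.add_apply, Matrix.sub_apply, sub_add, sub_mul, mul_sub,
        sub_mul, mul_sub, h1, h3, Matrix.map_apply, Matrix.map_apply, ← Algebra.commutes,
        ← Algebra.smul_def]
      abel
    have hβP : P * β = β * P := by
      ext1 p q
      rw [hPdef, hβ, Matrix.diagonal_mul, Matrix.mul_diagonal, Matrix.map_apply,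
        Algebra.commutes]
    -- Insert `X L = 1` in front and move `G` across `L`: the term with `G P` vanishes, and the
    -- defect `β P` is absorbed through `P X P = P`.
    have key : G * X * P = X * β * P := by
      calc G * X * P = X * (linearPencil e b * G) * X * P := by
            rw [← mul_assoc X, hXT, one_mul]
        _ = X * G * (linearPencil e b * X) * P + X * (β * P) * X * P := by
            rw [hcomm]; noncomm_ring
        _ = X * β * (P * X * P) := by
            rw [hTX, mul_one, mul_assoc X G, hGP, mul_zero, zero_add]; noncomm_ring
        _ = _ := by rw [hPXP]
    have h := DFunLike.congr_fun (congrFun (congrFun key p) q) (vacuum H)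
    rw [hGdef, hPdef, Matrix.mul_diagonal, Matrix.mul_diagonal, Matrix.diagonal_mul,
      Matrix.mul_apply] at h
    simp only [mul_apply_eq_comp, vacuumProj_vacuum] at h
    rw [h, _root_.sum_apply]
    refine Finset.sum_congr rfl fun m _ => ?_
    rw [hβ, Matrix.map_apply, ← Algebra.commutes, ← Algebra.smul_def]
    rfl

/-- Vectors in a finite dimensional subspace invariant under all `r_i^*` are of the form `c Ω`
with `c` in any algebra which contains the semicirculars and inverses near `1`. -/
theorem exists_mem_apply_vacuum_eq {C : Subalgebra ℂ (Fock H →L[ℂ] Fock H)}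
    (hC : IsNearOneClosed C) (hs : ∀ i, semicircular e i ∈ C) {V : Submodule ℂ (Fock H)}
    [FiniteDimensional ℂ V] (hV : ∀ i, ∀ x ∈ V, rightAnnihilation (e i) x ∈ V) {x : Fock H}
    (hx : x ∈ V) : ∃ c ∈ C, c (vacuum H) = x := by
  set B := stdOrthonormalBasis ℂ V with hB
  set v : Fin (Module.finrank ℂ V) → Fock H := fun q => (B q : Fock H) with hvdef
  have hv : Orthonormal ℂ v := B.orthonormal.comp_linearIsometry V.subtypeₗᵢ
  have hrep (y : V) : (y : Fock H) = ∑ q, ⟪B q, y⟫_ℂ • v q := by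
    conv_lhs => rw [← B.sum_repr' y]
    simp [hvdef]
  set b : Fin d → Matrix (Fin (Module.finrank ℂ V)) (Fin (Module.finrank ℂ V)) ℂ :=
    fun i => Matrix.of fun m q => ⟪B m, (⟨_, hV i _ (B q).2⟩ : V)⟫_ℂ with hb
  have hRv : ∀ i q, rightAnnihilation (e i) (v q) = ∑ m, b i m q • v m :=
    fun i q => hrep ⟨_, hV i _ (B q).2⟩
  obtain ⟨hX0, hX1⟩ := linearPencil_vacuum e hv hRv
  set X := Ring.inverse (linearPencil e b)
  -- Weighting the row index by the vacuum components of the `v p` gives `γ β Ω` the same vacuum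
  -- component as `∑ β_q v_q`; both transform by `β ↦ b_i β` under `r_i^*`.
  set γ : (Fin (Module.finrank ℂ V) → ℂ) → Fock H →L[ℂ] Fock H :=
    fun β => ∑ q, ∑ p, (⟪vacuum H, v p⟫_ℂ * β q) • X p q with hγ
  have hγR (i : Fin d) (β) : rightAnnihilation (e i) (γ β (vacuum H)) =
      γ ((b i).mulVec β) (vacuum H) := by
    simp only [hγ, _root_.sum_apply, map_sum, _root_.smul_apply, map_smul, hX1, Matrix.mulVec,
      dotProduct, Finset.mul_sum, Finset.sum_smul, Finset.smul_sum, smul_smul]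
    rw [Finset.sum_comm]
    conv_rhs => rw [Finset.sum_comm]
    refine Finset.sum_congr rfl fun p _ => ?_
    rw [Finset.sum_comm]
    refine Finset.sum_congr rfl fun m _ => Finset.sum_congr rfl fun q _ => ?_
    congr 1; ring
  have hzero (β) : γ β (vacuum H) - ∑ q, β q • v q = 0 := by
    refine eq_zero_of_orthogonal_vacuum e
      (S := Set.range fun β => γ β (vacuum H) - ∑ q, β q • v q) ?_ ?_ ⟨β, rfl⟩
    · rintro _ ⟨β, rfl⟩ i
      exact ⟨(b i).mulVec β, by
        simp only [map_sub]; rw [hγR, map_sum_smul_eq_mulVec (hRv := hRv)]⟩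
    · rintro _ ⟨β, rfl⟩
      simp only [hγ, inner_sub_right, inner_sum, inner_smul_right, _root_.sum_apply,
        _root_.smul_apply, hX0]
      simp [mul_comm]
  refine ⟨γ fun q => ⟪B q, (⟨x, hx⟩ : V)⟫_ℂ, ?_, ?_⟩
  · exact C.sum_mem fun q _ => C.sum_mem fun p _ =>
      C.smul_mem (inverse_linearPencil_mem e hC hs hv hRv p q) _
  · rw [sub_eq_zero.1 (hzero _)]
    exact (hrep ⟨x, hx⟩).symm

theorem mem_of_isFiniteRank_commutator {C : Subalgebra ℂ (Fock H →L[ℂ] Fock H)}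
    (hC : IsNearOneClosed C) (hs : ∀ i, semicircular e i ∈ C) (hCL : ∀ x ∈ C, x ∈ LInf e)
    {a : Fock H →L[ℂ] Fock H} (ha : a ∈ LInf e)
    (hfin : ∀ i, IsFiniteRank (rightAnnihilation (e i) * a - a * rightAnnihilation (e i))) :
    a ∈ C := by
  obtain ⟨V, hVfin, haV, hV⟩ := exists_finiteDimensional_invariant e ha hfin
  obtain ⟨c, hc, hcΩ⟩ := exists_mem_apply_vacuum_eq e hC hs hV haV
  have : c - a = 0 := eq_zero_of_apply_vacuum_eq_zero e (sub_mem (hCL c hc) ha) (by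
    rw [_root_.sub_apply, hcΩ, sub_self])
  rwa [← sub_eq_zero.1 this]

end Realization

end FreeFock

/-! ### Finite rank commutators and closures -/

namespace FreeFock
open Filter Topology ContinuousLinearMap
open scoped InnerProductSpace

section Closures

/-- The closure of a subalgebra contains the inverses of its elements close to `1`. -/
theorem isNearOneClosed_topologicalClosure {A : Type*} [NormedRing A] [Algebra ℂ A]
    (C : Subalgebra ℂ A) : IsNearOneClosed C.topologicalClosure := by
  intro x hx hx1
  have hmem (k : ℕ) : ∑ j ∈ Finset.range k, (1 - (x : A)) ^ j ∈ C.topologicalClosure :=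
    sum_mem fun j _ => pow_mem (sub_mem (one_mem _) hx) j
  have hlim : Tendsto (fun k => ∑ j ∈ Finset.range k, (1 - (x : A)) ^ j) atTop
      (𝓝 ((x⁻¹ : Aˣ) : A)) := by
    have h (k : ℕ) : ∑ j ∈ Finset.range k, (1 - (x : A)) ^ j =
        (x⁻¹ : Aˣ) - (x⁻¹ : Aˣ) * (1 - (x : A)) ^ k := by
      have := mul_neg_geom_sum (1 - (x : A)) k
      rw [sub_sub_cancel] at this
      rw [← mul_one_sub, ← this, Units.inv_mul_cancel_left]
    simp_rw [h]
    have h0 : Tendsto (fun k => (1 - (x : A)) ^ k) atTop (𝓝 0) :=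
      tendsto_pow_atTop_nhds_zero_of_norm_lt_one (by rwa [norm_sub_rev])
    simpa using (h0.const_mul ((x⁻¹ : Aˣ) : A)).const_sub ((x⁻¹ : Aˣ) : A)
  exact C.isClosed_topologicalClosure.mem_of_tendsto hlim (Eventually.of_forall hmem)

theorem IsRationallyClosed.isDivisionClosed {A : Type*} [Ring A] [Algebra ℂ A]
    {C : Subalgebra ℂ A} (hC : IsRationallyClosed C) : IsDivisionClosed C := by
  intro x hx
  exact hC 1 (Units.map (Matrix.scalar (Fin 1) : A →+* Matrix (Fin 1) (Fin 1) A).toMonoidHom x)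
    (fun i j => by fin_cases i; fin_cases j; simpa using hx) 0 0

end Closures

variable {H : Type u} [NormedAddCommGroup H] [InnerProductSpace ℂ H] [FiniteDimensional ℂ H]
  {d : ℕ} (e : OrthonormalBasis (Fin d) ℂ H)

/-- The inclusion of `L^∞(s)` into the bounded operators on the Fock space. -/
def LInfIncl : LInfAlg e →ₐ[ℂ] (Fock H →L[ℂ] Fock H) := (LInf e).toStarSubalgebra.toSubalgebra.val

theorem isNearOneClosed_map_LInfIncl {C : Subalgebra ℂ (LInfAlg e)} (hC : IsNearOneClosed C) :
    IsNearOneClosed (C.map (LInfIncl e)) := by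
  rintro x ⟨y, hy, hyx⟩ hx1
  have hyx' : (y : Fock H →L[ℂ] Fock H) = x := hyx
  have hxL : (x : Fock H →L[ℂ] Fock H) ∈ LInf e := hyx' ▸ y.2
  -- A commutant contains inverses, so a unit of the bounded operators lying in `L^∞(s)` is already
  -- a unit there.
  let z : (LInfAlg e)ˣ := ⟨y, ⟨_, inv_mem_LInf e hxL⟩, Subtype.ext (by
      change (y : Fock H →L[ℂ] Fock H) * _ = 1
      rw [hyx', Units.mul_inv]), Subtype.ext (by
      change _ * (y : Fock H →L[ℂ] Fock H) = 1
      rw [hyx', Units.inv_mul])⟩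
  refine ⟨_, hC z hy ?_, rfl⟩
  rw [← hyx'] at hx1
  exact hx1

theorem mem_of_isFiniteRank_commutator_LInf {C : Subalgebra ℂ (LInfAlg e)} (hC : IsNearOneClosed C)
    (hp : polys e ≤ C) (a : LInfAlg e)
    (ha : ∀ i, IsFiniteRank (rightAnnihilation (e i) * (a : Fock H →L[ℂ] Fock H) -
      (a : Fock H →L[ℂ] Fock H) * rightAnnihilation (e i))) : a ∈ C := by
  obtain ⟨y, hy, hya⟩ := mem_of_isFiniteRank_commutator e (isNearOneClosed_map_LInfIncl e hC)
    (fun i => ⟨s e i, hp (Algebra.subset_adjoin ⟨i, rfl⟩), rfl⟩)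
    (by rintro _ ⟨y, -, rfl⟩; exact y.2) a.2 ha
  rwa [← Subtype.ext hya]

/-! ### The ideal of finite rank operators -/

section FiniteRank

variable {K : Type u} [NormedAddCommGroup K] [InnerProductSpace ℂ K] {S T : K →L[ℂ] K}

theorem IsFiniteRank.zero : IsFiniteRank (0 : K →L[ℂ] K) := by
  have : LinearMap.range ((0 : K →L[ℂ] K) : K →ₗ[ℂ] K) = ⊥ := LinearMap.range_zero
  rw [IsFiniteRank, this]; infer_instance

theorem IsFiniteRank.add (hS : IsFiniteRank S) (hT : IsFiniteRank T) : IsFiniteRank (S + T) := by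
  unfold IsFiniteRank at *
  exact Submodule.finiteDimensional_of_le
    (LinearMap.range_add_le (S : K →ₗ[ℂ] K) (T : K →ₗ[ℂ] K))

theorem IsFiniteRank.mul_left (S : K →L[ℂ] K) (hT : IsFiniteRank T) : IsFiniteRank (S * T) := by
  unfold IsFiniteRank at *
  have : LinearMap.range ((S * T : K →L[ℂ] K) : K →ₗ[ℂ] K) =
    (LinearMap.range (T : K →ₗ[ℂ] K)).map (S : K →ₗ[ℂ] K) := LinearMap.range_comp _ _
  rw [this]; infer_instance

theorem IsFiniteRank.mul_right (hS : IsFiniteRank S) (T : K →L[ℂ] K) : IsFiniteRank (S * T) := by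
  unfold IsFiniteRank at *
  exact Submodule.finiteDimensional_of_le
    (LinearMap.range_comp_le_range (T : K →ₗ[ℂ] K) (S : K →ₗ[ℂ] K))

theorem IsFiniteRank.neg (hT : IsFiniteRank T) : IsFiniteRank (-T) := by
  simpa using hT.mul_left (-1)

theorem IsFiniteRank.sum {ι : Type*} (t : Finset ι) {f : ι → K →L[ℂ] K}
    (h : ∀ i ∈ t, IsFiniteRank (f i)) : IsFiniteRank (∑ i ∈ t, f i) :=
  Finset.sum_induction f IsFiniteRank (fun _ _ => IsFiniteRank.add) IsFiniteRank.zero h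

end FiniteRank

/-- The elements of `L^∞(s)` whose commutators with all `r_i^*` have finite rank. -/
def finiteRankCommutators : Subalgebra ℂ (LInfAlg e) where
  carrier := {a | ∀ i, IsFiniteRank (rightAnnihilation (e i) * (a : Fock H →L[ℂ] Fock H) -
      (a : Fock H →L[ℂ] Fock H) * rightAnnihilation (e i))}
  mul_mem' {a b} ha hb i := by
    have : rightAnnihilation (e i) * ((a * b : LInfAlg e) : Fock H →L[ℂ] Fock H) -
        ((a * b : LInfAlg e) : Fock H →L[ℂ] Fock H) * rightAnnihilation (e i) =
        (rightAnnihilation (e i) * (a : Fock H →L[ℂ] Fock H) -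
          (a : Fock H →L[ℂ] Fock H) * rightAnnihilation (e i)) * (b : Fock H →L[ℂ] Fock H) +
        (a : Fock H →L[ℂ] Fock H) * (rightAnnihilation (e i) * (b : Fock H →L[ℂ] Fock H) -
          (b : Fock H →L[ℂ] Fock H) * rightAnnihilation (e i)) := by
      rw [MulMemClass.coe_mul]; noncomm_ring
    rw [this]
    exact ((ha i).mul_right _).add ((hb i).mul_left _)
  add_mem' {a b} ha hb i := by
    have := (ha i).add (hb i)
    rwa [sub_add_sub_comm, ← mul_add, ← add_mul] at this
  algebraMap_mem' c i := by
    have : rightAnnihilation (e i) * (algebraMap ℂ (LInfAlg e) c : Fock H →L[ℂ] Fock H) -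
        (algebraMap ℂ (LInfAlg e) c : Fock H →L[ℂ] Fock H) * rightAnnihilation (e i) = 0 :=
      sub_eq_zero.2 (Algebra.commutes (A := Fock H →L[ℂ] Fock H) c (rightAnnihilation (e i))).symm
    rw [this]
    exact IsFiniteRank.zero

theorem isFiniteRank_vacuumProj : IsFiniteRank (vacuumProj H) :=
  Submodule.finiteDimensional_of_le (S₂ := Submodule.span ℂ {vacuum H}) (by
    rintro _ ⟨x, rfl⟩
    exact Submodule.smul_mem _ _ (Submodule.mem_span_singleton_self _))

theorem polys_le_finiteRankCommutators : polys e ≤ finiteRankCommutators e := by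
  refine Algebra.adjoin_le ?_
  rintro _ ⟨j, rfl⟩ i
  change IsFiniteRank (rightAnnihilation (e i) * semicircular e j -
    semicircular e j * rightAnnihilation (e i))
  rw [rightAnnihilation_commutator_semicircular]
  split_ifs
  exacts [isFiniteRank_vacuumProj, IsFiniteRank.zero]

theorem isRationallyClosed_finiteRankCommutators :
    IsRationallyClosed (finiteRankCommutators e) := by
  intro n Z hZ p q i
  set X := (LInfIncl e).mapMatrix (Z : Matrix (Fin n) (Fin n) (LInfAlg e)) with hX
  set Y := (LInfIncl e).mapMatrix ((Z⁻¹ : (Matrix (Fin n) (Fin n) (LInfAlg e))ˣ) :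
    Matrix (Fin n) (Fin n) (LInfAlg e)) with hY
  have hXY : X * Y = 1 := by rw [hX, hY, ← map_mul, Units.mul_inv, map_one]
  have hYX : Y * X = 1 := by rw [hX, hY, ← map_mul, Units.inv_mul, map_one]
  set G : Matrix (Fin n) (Fin n) (Fock H →L[ℂ] Fock H) :=
    Matrix.diagonal fun _ => rightAnnihilation (e i) with hG
  -- The derivation rule for inverses reduces each entry to a finite sum of products containing one
  -- commutator of an entry of `X`.
  have key : G * Y - Y * G = -(Y * (G * X - X * G) * Y) := by
    rw [mul_sub, sub_mul, ← mul_assoc Y X, hYX, one_mul, mul_assoc Y (G * X), mul_assoc G X, hXY,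
      mul_one, neg_sub]
  have h := congrFun (congrFun key p) q
  rw [Matrix.sub_apply, hG, Matrix.diagonal_mul, Matrix.mul_diagonal] at h
  change IsFiniteRank (rightAnnihilation (e i) * Y p q - Y p q * rightAnnihilation (e i))
  rw [h, Matrix.neg_apply, Matrix.mul_apply]
  refine (IsFiniteRank.sum _ fun m _ => IsFiniteRank.mul_right ?_ _).neg
  rw [Matrix.mul_apply]
  refine IsFiniteRank.sum _ fun k _ => IsFiniteRank.mul_left _ ?_
  rw [Matrix.sub_apply, Matrix.diagonal_mul, Matrix.mul_diagonal]
  exact hZ k m i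

end FreeFock
end

/-! ### The cycle of inclusions -/

theorem theorem3p1 {d : ℕ} (hd : 0 < d) {H : Type u} [NormedAddCommGroup H]
    [InnerProductSpace ℂ H] [FiniteDimensional ℂ H] (e : OrthonormalBasis (Fin d) ℂ H) :
    (∀ a : FreeFock.LInfAlg e,
      (∀ i : Fin d, FreeFock.IsFiniteRank
        (FreeFock.rightAnnihilation (e i) * (a : FreeFock.Fock H →L[ℂ] FreeFock.Fock H) -
          (a : FreeFock.Fock H →L[ℂ] FreeFock.Fock H) * FreeFock.rightAnnihilation (e i))) ↔
        a ∈ FreeFock.Cdiv e) ∧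
    FreeFock.Cdiv e = FreeFock.Crat e ∧
    (FreeFock.Crat e : Set (FreeFock.LInfAlg e)) ⊆
      closure (FreeFock.polys e : Set (FreeFock.LInfAlg e)) := by
  have hdiv := FreeFock.divisionClosure_isLeast (FreeFock.polys e)
  have hrat := FreeFock.rationalClosure_isLeast (FreeFock.polys e)
  have h1 : FreeFock.Cdiv e ≤ FreeFock.Crat e := hdiv.2 ⟨hrat.1.1, hrat.1.2.isDivisionClosed⟩
  have h2 : FreeFock.Crat e ≤ FreeFock.finiteRankCommutators e :=
    hrat.2 ⟨FreeFock.polys_le_finiteRankCommutators e,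
      FreeFock.isRationallyClosed_finiteRankCommutators e⟩
  have h3 : FreeFock.finiteRankCommutators e ≤ FreeFock.Cdiv e := fun a ha =>
    FreeFock.mem_of_isFiniteRank_commutator_LInf e (fun x hx _ => hdiv.1.2 x hx) hdiv.1.1 a ha
  -- The realization argument is run again with the norm closure, where Neumann series supply the
  -- inverses near `1`.
  have h4 : FreeFock.finiteRankCommutators e ≤ (FreeFock.polys e).topologicalClosure := fun a ha =>
    FreeFock.mem_of_isFiniteRank_commutator_LInf e
      (FreeFock.isNearOneClosed_topologicalClosure _) (Subalgebra.le_topologicalClosure _) a ha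
  exact ⟨fun a => ⟨fun ha => h3 ha, fun ha => h2 (h1 ha)⟩, le_antisymm h1 (h2.trans h3),
    fun a ha => h4 (h2 ha)⟩
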